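/- Let $\Omega$ be either a compact convex subset of $\mathbb{R}^d$ with nonempty interior or the flat torus $\mathbb{T}^d=\mathbb{R}^d/\mathbb{Z}^d$. Let $\mathcal{P}(\Omega)$ be the set of smooth probability densities on $\Omega$, and let $\mathrm{Dist}_{\mathrm T}$ be the $L^2$-Wasserstein distance on $\mathcal{P}(\Omega)$: $\mathrm{Dist}_{\mathrm T}(p,q)^2$ is the minimum of $\int d_\Omega(x,y)^2\,d\pi(x,y)$ over the couplings $\pi$ of $p$ and $q$, where $d_\Omega$ is the Euclidean distance (on the torus, the flat distance). A function $\eta\in C^\infty(\Omega)$ is called an $L^2$ first variation $\frac{\delta}{\delta q}G(q)$ of a functional $G\colon\mathcal{P}(\Omega)\to\mathbb{R}$ at $q$ if $\frac{d}{dt}\big|_{t=0}G(q+t\sigma)=\int_\Omega\eta\,\sigma\,dx$ for every $\sigma\in C^\infty(\Omega)$ with $\int_\Omega\sigma\,dx=0$ and $q+t\sigma\in\mathcal{P}(\Omega)$ for all small $|t|$. The tangent vectors at $q$ are the functions $\sigma=-\nabla\cdot(q\nabla\Psi)$, where $\Psi\in C^\infty(\Omega)$ satisfies $q\,\nabla\Psi\cdot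 n=0$ for every outward normal $n$ at every boundary point of $\Omega$ (no condition on the torus), and the Wasserstein metric is $g_{\mathrm T}(q)(\sigma_1,\sigma_2)=\int_\Omega(\nabla\Psi_1,\nabla\Psi_2)\,q\,dx$ for $\sigma_i=-\nabla\cdot(q\nabla\Psi_i)$. The Wasserstein gradient $\mathrm{grad}_{\mathrm T}\mathcal F(q)$ is the tangent vector with $g_{\mathrm T}(q)(\mathrm{grad}_{\mathrm T}\mathcal F(q),\sigma)=\int_\Omega\frac{\delta}{\delta q}\mathcal F(q)\,\sigma\,dx$ for every tangent vector $\sigma$ at $q$. Let $\mathcal F\colon\mathcal P(\Omega)\to\mathbb R$ and $p,q\in\mathcal P(\Omega)$, with $q>0$ in the interior of $\Omega$. Suppose that $\mathcal F$ has a (smooth) $L^2$ first variation $\frac{\delta}{\delta q}\mathcal F(q)$ at $q$ and that, if $\Omega$ is a convex body, $q\,\nabla\frac{\delta}{\delta q}\mathcal F(q)\cdot n=0$ for every outward normal $n$ at every boundary point. Suppose also that there is a smooth strictly convex function $\Phi_p$ (on the torus: a smooth strictly convex function on $\mathbb{R}^d$ with $\Phi_p(x)-\frac12\|x\|^2$ periodic)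 whose gradient $T=\nabla\Phi_p$ maps $\Omega$ (on the torus: $\mathbb{R}^d$) bijectively onto itself and pushes $q$ forward to $p$, i.e. $p(T(x))\det(\nabla T(x))=q(x)$. Define the transport Bregman divergence $$\mathrm D_{\mathrm T,\mathcal F}(p\|q)=\mathcal F(p)-\mathcal F(q)-\int_\Omega\Big(\nabla_x\tfrac{\delta}{\delta q(x)}\mathcal F(q),\,T(x)-x\Big)q(x)\,dx .$$ Then the Wasserstein gradient of $\mathcal F$ at $q$ exists, with $\mathrm{grad}_{\mathrm T}\mathcal F(q)=-\nabla_x\cdot\big(q\nabla_x\frac{\delta}{\delta q}\mathcal F(q)\big)$; the functional $r\mapsto\mathrm{Dist}_{\mathrm T}(p,r)^2$ has an $L^2$ first variation at $q$; and $$\mathrm D_{\mathrm T,\mathcal F}(p\|q)=\mathcal F(p)-\mathcal F(q)+\frac12\int_\Omega\mathrm{grad}_{\mathrm T}\mathcal F(q)(x)\cdot\frac{\delta}{\delta q(x)}\mathrm{Dist}_{\mathrm T}(p,q)^2\,dx ,$$ for every choice of the first variation of the squared distance (it is determined up to an additive constant). -/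

import Mathlib

open MeasureTheory Filter Topology Set
open scoped ContDiff RealInnerProductSpace

noncomputable section

/-- The sample spaces `Ω`: a compact convex subset of `ℝᵈ` with nonempty interior, or the flat
torus `ℝᵈ / ℤᵈ`. -/
inductive SampleSpace (d : ℕ) : Type
  | convexBody (K : Set (EuclideanSpace ℝ (Fin d))) (isCompact : IsCompact K)
      (convex : Convex ℝ K) (nonempty_interior : (interior K).Nonempty) : SampleSpace d
  | torus : SampleSpace d

namespace SampleSpace

variable {d : ℕ}

/-- The set on which functions on `Ω` are defined: `Ω` itself for a convex body. Functions on the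
torus are the `ℤᵈ`-periodic functions on `ℝᵈ`. -/
def cover : SampleSpace d → Set (EuclideanSpace ℝ (Fin d))
  | convexBody K _ _ _ => K
  | torus => univ

/-- The periods of functions on `Ω`: only `0` for a convex body, and `ℤᵈ` for the torus. -/
def periods : SampleSpace d → Set (EuclideanSpace ℝ (Fin d))
  | convexBody _ _ _ _ => {0}
  | torus => {k | ∀ i, ∃ m : ℤ, k i = m}

/-- The set over which one integrates: `Ω` for a convex body, and the unit cell `[0,1)ᵈ` for the
torus. -/
def cell : SampleSpace d → Set (EuclideanSpace ℝ (Fin d))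
  | convexBody K _ _ _ => K
  | torus => {x | ∀ i, x i ∈ Ico (0 : ℝ) 1}

/-- `f ∈ C^∞(Ω)` (smooth up to the boundary for a convex body, periodic for the torus). -/
def IsSmooth (X : SampleSpace d) (f : EuclideanSpace ℝ (Fin d) → ℝ) : Prop :=
  ContDiffOn ℝ ∞ f X.cover ∧ ∀ x ∈ X.cover, ∀ k ∈ X.periods, f (x + k) = f x

/-- The integral `∫_Ω f(x) dx`. -/
def integral (X : SampleSpace d) (f : EuclideanSpace ℝ (Fin d) → ℝ) : ℝ :=
  ∫ x in X.cell, f x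

/-- The spatial gradient `∇ₓ f` on `Ω`. -/
def grad (X : SampleSpace d) (f : EuclideanSpace ℝ (Fin d) → ℝ) :
    EuclideanSpace ℝ (Fin d) → EuclideanSpace ℝ (Fin d) :=
  gradientWithin f X.cover

/-- The spatial divergence `∇ₓ · v` on `Ω`. -/
def div (X : SampleSpace d) (v : EuclideanSpace ℝ (Fin d) → EuclideanSpace ℝ (Fin d))
    (x : EuclideanSpace ℝ (Fin d)) : ℝ :=
  ∑ i, (fderivWithin ℝ v X.cover x (EuclideanSpace.single i 1)) i

/-- The squared distance of `Ω`: `‖x - y‖²` for a convex body, and `min_{k ∈ ℤᵈ} ‖x - y - k‖²` for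
the torus. -/
def sqDist (X : SampleSpace d) (x y : EuclideanSpace ℝ (Fin d)) : ℝ :=
  ⨅ k : X.periods, ‖x - y - k‖ ^ 2

/-- The space `𝒫(Ω)` of smooth probability densities on `Ω`. (For a convex body a function on `Ω`
is extended by zero, so that two densities are equal iff they agree on `Ω`.) -/
structure Density (X : SampleSpace d) where
  toFun : EuclideanSpace ℝ (Fin d) → ℝ
  smooth : X.IsSmooth toFun
  nonneg : ∀ x ∈ X.cover, 0 ≤ toFun x
  integral_eq_one : X.integral toFun = 1
  eq_zero_of_notMem : ∀ x, x ∉ X.cover → toFun x = 0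

instance (X : SampleSpace d) :
    CoeFun (Density X) (fun _ => EuclideanSpace ℝ (Fin d) → ℝ) :=
  ⟨Density.toFun⟩

/-- The probability measure `p(x) dx` on `Ω` (for the torus: on its unit cell). -/
def Density.toMeasure {X : SampleSpace d} (p : Density X) :
    Measure (EuclideanSpace ℝ (Fin d)) :=
  (volume.restrict X.cell).withDensity (fun x => ENNReal.ofReal (p x))

/-- The `L²`-Wasserstein distance `Dist_T(p,q)`: the square root of the minimal quadratic cost of
the joint distributions `π` with marginals `p` and `q`. -/
def wassersteinDist (X : SampleSpace d) (p q : Density X) : ℝ :=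
  Real.sqrt (sInf {c : ℝ | ∃ π : Measure (EuclideanSpace ℝ (Fin d) × EuclideanSpace ℝ (Fin d)),
    π.map Prod.fst = p.toMeasure ∧ π.map Prod.snd = q.toMeasure ∧
      c = ∫ z, X.sqDist z.1 z.2 ∂π})

/-- `η = δG/δq(x)`: the smooth function `η` on `Ω` is an `L²` first variation of the functional
`G` at `q`, i.e. `d/dt G(q + t σ) = ∫ η σ dx` at `t = 0` for every smooth `σ` of zero mean such
that `q + t σ` is a density for all small `|t|`. (It is determined up to an additive constant.) -/
def IsFirstVariation (X : SampleSpace d) (G : Density X → ℝ) (q : Density X)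
    (η : EuclideanSpace ℝ (Fin d) → ℝ) : Prop :=
  X.IsSmooth η ∧
    ∀ σ : EuclideanSpace ℝ (Fin d) → ℝ, X.IsSmooth σ → X.integral σ = 0 →
      ∀ c : ℝ → Density X, (∀ᶠ t in 𝓝 (0 : ℝ), ∀ x ∈ X.cover, c t x = q x + t * σ x) →
        HasDerivAt (fun t => G (c t)) (X.integral fun x => η x * σ x) 0

/-- The function `-∇ₓ · (q ∇ₓ Φ)`. -/
def tangent (X : SampleSpace d) (q : Density X) (Φ : EuclideanSpace ℝ (Fin d) → ℝ) :
    EuclideanSpace ℝ (Fin d) → ℝ :=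
  fun x => -X.div (fun y => q y • X.grad Φ y) x

/-- `Φ ∈ C^∞(Ω)` is the potential of a tangent vector `-∇·(q ∇Φ)` at `q`: no mass flows through
the boundary, i.e. `q ∇Φ` is orthogonal to every outward normal `n` of `Ω`, at every point of `Ω`.
(On the torus, and in the interior of a convex body, the only normal is `n = 0`.) -/
def IsTangentPotential (X : SampleSpace d) (q : Density X)
    (Φ : EuclideanSpace ℝ (Fin d) → ℝ) : Prop :=
  X.IsSmooth Φ ∧
    ∀ x ∈ X.cover, ∀ n : EuclideanSpace ℝ (Fin d), (∀ y ∈ X.cover, ⟪n, y - x⟫ ≤ 0) →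
      q x * ⟪X.grad Φ x, n⟫ = 0

/-- The Wasserstein metric `g_T(q)(σ₁, σ₂) = ∫ (∇Φ₁, ∇Φ₂) q dx` of the tangent vectors
`σᵢ = -∇·(q ∇Φᵢ)`, in terms of their potentials. -/
def metric (X : SampleSpace d) (q : Density X) (Φ₁ Φ₂ : EuclideanSpace ℝ (Fin d) → ℝ) : ℝ :=
  X.integral fun x => ⟪X.grad Φ₁ x, X.grad Φ₂ x⟫ * q x

/-- `ζ = grad_T F(q)`, where `f` is the `L²` first variation of `F` at `q`: the function `ζ` on `Ω`
is a tangent vector at `q`, and `g_T(q)(ζ, σ) = ∫ f σ dx` for every tangent vector `σ` at `q`. -/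
def IsWassersteinGradient (X : SampleSpace d) (q : Density X)
    (f ζ : EuclideanSpace ℝ (Fin d) → ℝ) : Prop :=
  ∃ Ψ, X.IsTangentPotential q Ψ ∧ (∀ x ∈ X.cover, ζ x = X.tangent q Ψ x) ∧
    ∀ Φ, X.IsTangentPotential q Φ →
      X.metric q Ψ Φ = X.integral fun x => f x * X.tangent q Φ x

/-- `Φ = Φ_p` is the transport coordinate of `p` relative to `q`: a smooth strictly convex function
whose gradient `T = ∇Φ` maps `Ω` bijectively onto itself and pushes `q` forward to `p`, i.e.
`p(T(x)) det(∇T(x)) = q(x)`. (On the torus, `Φ - ‖x‖²/2` is periodic, so that `T(x) - x` is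
periodic, and `T` is the lift to `ℝᵈ` of a map of the torus.) -/
def IsTransportPotential (X : SampleSpace d) (q p : Density X)
    (Φ : EuclideanSpace ℝ (Fin d) → ℝ) : Prop :=
  X.IsSmooth (fun x => Φ x - ‖x‖ ^ 2 / 2) ∧ StrictConvexOn ℝ X.cover Φ ∧
    BijOn (X.grad Φ) X.cover X.cover ∧
    ∀ x ∈ X.cover, p (X.grad Φ x) * (fderivWithin ℝ (X.grad Φ) X.cover x).det = q x

/-- The transport Bregman divergence
`D_{T,F}(p‖q) = F(p) - F(q) - ∫ (∇ₓ f, ∇ₓ Φ - x) q dx`, where `f` is the `L²` first variation of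
`F` at `q` and `Φ` is the transport coordinate of `p` relative to `q`. -/
def transportBregman (X : SampleSpace d) (F : Density X → ℝ) (p q : Density X)
    (f Φ : EuclideanSpace ℝ (Fin d) → ℝ) : ℝ :=
  F p - F q - X.integral fun x => ⟪X.grad f x, X.grad Φ x - x⟫ * q x

end SampleSpace

end

/-!
The potential `η = ‖x‖² - 2 Φ` is a first variation of the squared Wasserstein distance to `p`.
Kantorovich duality with the pair formed by `η` and its `c`-transform bounds `Dist_T(p, r)²` from
below by an affine function of the density `r`, with equality at `r = q`. For the upper bound, let
`r = q + t σ`. In the interior of `Ω` mass can be moved in many short steps, because `q` is bounded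
below there, so `q` and `r` have a coupling of quadratic cost `o(t)`. Transporting its first
marginal by `T = ∇Φ` couples `p` and `r`, and since `T` is Lipschitz the cost exceeds the affine
function by at most a multiple of the cost of the coupling.

The Wasserstein gradient comes from integration by parts: for a field `v` tangential to the
boundary, `x + t v(x)` stays within `O(t²)` of the convex set `Ω`, so the volume of its image does
not change to first order in `t`, and the divergence of `v` has zero integral. The potential of a
tangent vector is unique up to `q`-null sets of its gradient, and the first variation is unique up
to constants, so `∫ ζ η = g_T(f, ‖x‖² - 2 Φ) = -2 ∫ (∇f, ∇Φ - x) q`.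
-/

open scoped NNReal ENNReal

local notation "𝔼" d:max => EuclideanSpace ℝ (Fin d)

section Determinant

variable {E : Type*} [NormedAddCommGroup E] [NormedSpace ℝ E]

theorem one_add_smul_mem_closedBall {A : E →L[ℝ] E} {L t : ℝ} (hA : ‖A‖ ≤ L) (ht : |t| ≤ 1) :
    1 + t • A ∈ Metric.closedBall 1 L := by
  rw [mem_closedBall_iff_norm, add_sub_cancel_left, norm_smul, Real.norm_eq_abs]
  exact (mul_le_of_le_one_left (norm_nonneg A) ht).trans hA

variable [FiniteDimensional ℝ E]

theorem det_eq_det_toMatrix_finBasis (A : E →L[ℝ] E) :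
    A.det = (LinearMap.toMatrix (Module.finBasis ℝ E) (Module.finBasis ℝ E)
      (A : E →ₗ[ℝ] E)).det := by
  rw [LinearMap.det_toMatrix]

theorem contDiff_det {n : WithTop ℕ∞} : ContDiff ℝ n fun A : E →L[ℝ] E => A.det := by
  simp_rw [det_eq_det_toMatrix_finBasis, Matrix.det_apply]
  refine ContDiff.sum fun σ _ => ContDiff.const_smul _ (contDiff_prod fun i _ => ?_)
  let entry : (E →L[ℝ] E) →ₗ[ℝ] ℝ :=
    (Matrix.entryLinearMap ℝ ℝ (σ i) i) ∘ₗ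
      (LinearMap.toMatrix (Module.finBasis ℝ E) (Module.finBasis ℝ E)).toLinearMap ∘ₗ
        ContinuousLinearMap.coeLM ℝ
  exact (LinearMap.toContinuousLinearMap entry).contDiff

theorem hasDerivAt_det_one_add_smul (A : E →L[ℝ] E) :
    HasDerivAt (fun t : ℝ => (1 + t • A).det) (LinearMap.trace ℝ E A) 0 := by
  let b := Module.finBasis ℝ E
  let M := LinearMap.toMatrix b b (A : E →ₗ[ℝ] E)
  let R := (Matrix.det (1 + (Polynomial.X : Polynomial ℝ) • M.map Polynomial.C)).divX.divX
  have det_eq (t : ℝ) : (1 + t • A).det = 1 + M.trace * t + R.eval t * t ^ 2 := by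
    have coe_eq : ((1 + t • A : E →L[ℝ] E) : E →ₗ[ℝ] E) = LinearMap.id + t • A.toLinearMap := rfl
    rw [← Matrix.det_one_add_smul, det_eq_det_toMatrix_finBasis, coe_eq, map_add, map_smul,
      LinearMap.toMatrix_id]
  simp_rw [det_eq, LinearMap.trace_eq_matrix_trace ℝ b]
  refine ((((hasDerivAt_id (0 : ℝ)).const_mul M.trace).const_add 1).add
    ((R.hasDerivAt 0).mul (hasDerivAt_pow 2 (0 : ℝ)))).congr_deriv ?_
  simp [M]

variable {α : Type*} {mα : MeasurableSpace α} {μ : Measure α} [IsFiniteMeasure μ]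
  {A : α → E →L[ℝ] E} {L : ℝ}

theorem integrable_det_one_add_smul (hA : AEStronglyMeasurable A μ) (hL : ∀ᵐ x ∂μ, ‖A x‖ ≤ L)
    {t : ℝ} (ht : |t| ≤ 1) : Integrable (fun x => (1 + t • A x).det) μ := by
  have : ProperSpace (E →L[ℝ] E) := FiniteDimensional.proper ℝ _
  obtain ⟨C, hC⟩ := (isCompact_closedBall (1 : E →L[ℝ] E) L).exists_bound_of_continuousOn
    ContinuousLinearMap.continuous_det.continuousOn
  refine .of_bound (ContinuousLinearMap.continuous_det.comp_aestronglyMeasurable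
    (aestronglyMeasurable_const.add (hA.const_smul t))) C ?_
  filter_upwards [hL] with x hx using hC _ (one_add_smul_mem_closedBall hx ht)

theorem hasDerivAt_integral_det_one_add_smul (hA : AEStronglyMeasurable A μ)
    (hL : ∀ᵐ x ∂μ, ‖A x‖ ≤ L) :
    HasDerivAt (fun t : ℝ => ∫ x, (1 + t • A x).det ∂μ)
      (∫ x, LinearMap.trace ℝ E (A x) ∂μ) 0 := by
  have : ProperSpace (E →L[ℝ] E) := FiniteDimensional.proper ℝ _
  obtain ⟨K, hK⟩ := contDiff_det.contDiffOn.exists_lipschitzOnWith one_ne_zero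
    (convex_closedBall (1 : E →L[ℝ] E) L) (isCompact_closedBall _ _)
  let trace : (E →L[ℝ] E) →ₗ[ℝ] ℝ := (LinearMap.trace ℝ E) ∘ₗ (ContinuousLinearMap.coeLM ℝ)
  refine (hasDerivAt_integral_of_dominated_loc_of_lip (𝕜 := ℝ)
    (F := fun t x => (1 + t • A x).det) (F' := fun x => LinearMap.trace ℝ E (A x)) (s := Icc (-1) 1)
    (bound := fun _ => K * L) (Icc_mem_nhds (by norm_num) (by norm_num))
    (.of_forall fun t => ContinuousLinearMap.continuous_det.comp_aestronglyMeasurable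
      (aestronglyMeasurable_const.add (hA.const_smul t)))
    (integrable_det_one_add_smul hA hL (by simp))
    (trace.continuous_of_finiteDimensional.comp_aestronglyMeasurable hA)
    ?_ (integrable_const _) (.of_forall fun x => hasDerivAt_det_one_add_smul _)).2
  filter_upwards [hL] with x hx
  refine LipschitzOnWith.of_dist_le_mul fun s hs t ht => ?_
  rw [Real.coe_nnabs]
  calc dist (1 + s • A x).det (1 + t • A x).det
      ≤ K * dist (1 + s • A x) (1 + t • A x) :=
        hK.dist_le_mul _ (one_add_smul_mem_closedBall hx (abs_le.2 hs)) _
          (one_add_smul_mem_closedBall hx (abs_le.2 ht))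
    _ = K * ‖A x‖ * dist s t := by
        rw [dist_add_left, dist_eq_norm, ← sub_smul, norm_smul, ← dist_eq_norm]; ring
    _ ≤ |(K : ℝ) * L| * dist s t := by
        gcongr
        exact (mul_le_mul_of_nonneg_left hx K.2).trans (le_abs_self _)

end Determinant

section Displacement

variable {E : Type*} [NormedAddCommGroup E] [NormedSpace ℝ E] {s : Set E} {v : E → E} {L : NNReal}

theorem injOn_add_smul (hL : LipschitzOnWith L v s) {t : ℝ} (ht : |t| * L < 1) :
    InjOn (fun x => x + t • v x) s := by
  intro x hx y hy hxy
  have sub_eq : x - y = t • (v y - v x) := by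
    rw [smul_sub, sub_eq_sub_iff_add_eq_add, add_comm _ y]
    exact hxy
  have norm_le : ‖x - y‖ ≤ |t| * L * ‖x - y‖ := calc
    ‖x - y‖ = |t| * ‖v y - v x‖ := by
      conv_lhs => rw [sub_eq, norm_smul, Real.norm_eq_abs]
    _ ≤ |t| * (L * ‖y - x‖) := by gcongr; exact hL.norm_sub_le hy hx
    _ = |t| * L * ‖x - y‖ := by rw [norm_sub_rev, mul_assoc]
  rw [← sub_eq_zero, ← norm_le_zero_iff]
  nlinarith [norm_nonneg (x - y)]

variable [FiniteDimensional ℝ E] [MeasurableSpace E] [BorelSpace E] {μ : Measure E}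
  [μ.IsAddHaarMeasure] {v' : E → E →L[ℝ] E}

theorem setIntegral_det_le_measureReal_image (hs : MeasurableSet s) (hμs : μ s ≠ ⊤)
    (hv : ∀ x ∈ s, HasFDerivWithinAt v (v' x) s x) (hv' : ∀ x ∈ s, ‖v' x‖ ≤ L)
    (hL : LipschitzOnWith L v s) (hm : AEStronglyMeasurable v' (μ.restrict s)) {t : ℝ}
    (ht : |t| ≤ 1) (htL : |t| * L < 1) :
    ∫ x in s, (1 + t • v' x).det ∂μ ≤ μ.real ((fun x => x + t • v x) '' s) := by
  have : IsFiniteMeasure (μ.restrict s) := isFiniteMeasure_restrict.2 hμs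
  have integrable_det := integrable_det_one_add_smul hm (ae_restrict_of_forall_mem hs hv') ht
  have hasFDeriv : ∀ x ∈ s, HasFDerivWithinAt (fun x => x + t • v x) (1 + t • v' x) s x :=
    fun x hx => (hasFDerivWithinAt_id x s).add ((hv x hx).const_smul t)
  rw [Measure.real, ← lintegral_abs_det_fderiv_eq_addHaar_image μ hs hasFDeriv
      (injOn_add_smul hL htL),
    ← integral_eq_lintegral_of_nonneg_ae (.of_forall fun x => abs_nonneg _)
      integrable_det.abs.aestronglyMeasurable]
  exact integral_mono integrable_det integrable_det.abs fun x => le_abs_self _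

theorem setIntegral_trace_fderiv_eq_zero (hs : MeasurableSet s) (hμs : μ s ≠ ⊤)
    (hv : ∀ x ∈ s, HasFDerivWithinAt v (v' x) s x) (hv' : ∀ x ∈ s, ‖v' x‖ ≤ L)
    (hL : LipschitzOnWith L v s) (hm : AEStronglyMeasurable v' (μ.restrict s)) {G : ℝ → ℝ}
    (hG : HasDerivAt G 0 0) (hG0 : G 0 = 1)
    (hvol : ∀ᶠ t in 𝓝 0, μ.real ((fun x => x + t • v x) '' s) ≤ G t * μ.real s) :
    ∫ x in s, LinearMap.trace ℝ E (v' x) ∂μ = 0 := by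
  have : IsFiniteMeasure (μ.restrict s) := isFiniteMeasure_restrict.2 hμs
  have small : ∀ᶠ t : ℝ in 𝓝 0, |t| ≤ 1 ∧ |t| * L < 1 := by
    have abs_le_one : ∀ᶠ t : ℝ in 𝓝 0, |t| ≤ 1 :=
      continuous_abs.continuousAt.eventually_le_const (by simp)
    have abs_mul_lt_one : ∀ᶠ t : ℝ in 𝓝 0, |t| * L < 1 :=
      (continuous_abs.mul continuous_const).continuousAt.eventually_lt_const (by simp)
    exact abs_le_one.and abs_mul_lt_one
  -- `∫ det (1 + t v') - G t μ(s)` vanishes at `t = 0` and is nonpositive for small `t`.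
  have isLocalMax : IsLocalMax (fun t => ∫ x in s, (1 + t • v' x).det ∂μ - G t * μ.real s) 0 := by
    filter_upwards [small, hvol] with t ht hvol_t
    have := (setIntegral_det_le_measureReal_image hs hμs hv hv' hL hm ht.1 ht.2).trans hvol_t
    simpa [hG0, ContinuousLinearMap.det] using this
  simpa using isLocalMax.hasDerivAt_eq_zero
    ((hasDerivAt_integral_det_one_add_smul hm (ae_restrict_of_forall_mem hs hv')).sub
      (hG.mul_const _))

end Displacement

section TangentialDisplacement

variable {E : Type*} [NormedAddCommGroup E] [InnerProductSpace ℝ E] {K : Set E} {a : E} {r : ℝ}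

/-- The field `v` is tangent to the boundary of the convex set `K`: it is orthogonal to every
outward normal of `K`, at every point of `K`. -/
def IsTangentialOn (v : E → E) (K : Set E) : Prop :=
  ∀ x ∈ K, ∀ n : E, (∀ y ∈ K, ⟪n, y - x⟫ ≤ 0) → ⟪v x, n⟫ = 0

theorem exists_mem_norm_add_smul_sub_le (hK : Convex ℝ K) (hc : IsCompact K) {v : E → E}
    {L : NNReal} {B : ℝ} (hL : LipschitzOnWith L v K) (hB : ∀ x ∈ K, ‖v x‖ ≤ B)
    (hv : IsTangentialOn v K) (t : ℝ) {x : E} (hx : x ∈ K) :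
    ∃ y ∈ K, ‖x + t • v x - y‖ ≤ L * B * t ^ 2 := by
  set z := x + t • v x with hz
  obtain ⟨y, hy, hyz⟩ := exists_norm_eq_iInf_of_complete_convex ⟨x, hx⟩ hc.isComplete hK z
  have normal := (norm_eq_iInf_iff_real_inner_le_zero hK hy).1 hyz
  have inner_eq_zero : ⟪z - y, v y⟫ = 0 := by
    rw [real_inner_comm]
    exact hv y hy _ normal
  have dist_projection : ‖x - y‖ ≤ |t| * B := by
    have sq_le : ‖x - y‖ ^ 2 ≤ ⟪x - z, x - y⟫ := by
      have := normal x hx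
      rw [← sub_add_sub_cancel x z y, ← real_inner_self_eq_norm_sq] at *
      rw [inner_add_left]
      linarith
    have le_mul := sq_le.trans (real_inner_le_norm _ _)
    have norm_sub : ‖x - z‖ ≤ |t| * B := by
      rw [hz, sub_add_cancel_left, norm_neg, norm_smul, Real.norm_eq_abs]
      gcongr
      exact hB x hx
    nlinarith [norm_nonneg (x - y), norm_nonneg (x - z)]
  refine ⟨y, hy, ?_⟩
  have sq_le : ‖z - y‖ ^ 2 ≤ ‖z - y‖ * (L * B * t ^ 2) := calc
    ‖z - y‖ ^ 2 = ⟪z - y, x - y⟫ + t * ⟪z - y, v x - v y⟫ := by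
      rw [inner_sub_right (z - y) (v x), inner_eq_zero, sub_zero, ← real_inner_smul_right,
        ← inner_add_right, ← real_inner_self_eq_norm_sq, sub_add_eq_add_sub]
    _ ≤ |t| * (‖z - y‖ * (L * ‖x - y‖)) := by
      refine (add_le_of_nonpos_left (normal x hx)).trans ((le_abs_self _).trans ?_)
      rw [abs_mul]
      gcongr
      exact (abs_real_inner_le_norm _ _).trans (by gcongr; exact hL.norm_sub_le hx hy)
    _ ≤ |t| * (‖z - y‖ * (L * (|t| * B))) := by gcongr
    _ = ‖z - y‖ * (L * B * t ^ 2) := by rw [← sq_abs t]; ring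
  have bound_nonneg : 0 ≤ L * B * t ^ 2 := by
    have := (norm_nonneg _).trans (hB x hx)
    positivity
  by_contra! hlt
  nlinarith

theorem mem_image_homothety_of_norm_sub_le (hK : Convex ℝ K) (ha : Metric.closedBall a r ⊆ K)
    {y z : E} (hy : y ∈ K) {κ : ℝ} (hκ : 0 < κ) (hz : ‖z - y‖ ≤ κ * r) :
    z ∈ AffineMap.homothety a (1 + κ) '' K := by
  have hw : a + κ⁻¹ • (z - y) ∈ K := ha <| by
    rwa [mem_closedBall_iff_norm, add_sub_cancel_left, norm_smul, norm_inv, Real.norm_eq_abs,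
      abs_of_pos hκ, inv_mul_le_iff₀ hκ]
  refine ⟨(1 / (1 + κ)) • y + (κ / (1 + κ)) • (a + κ⁻¹ • (z - y)),
    hK hy hw (by positivity) (by positivity) (by field_simp), ?_⟩
  rw [AffineMap.homothety_apply, vsub_eq_sub, vadd_eq_add]
  match_scalars <;> field_simp <;> ring

end TangentialDisplacement

section TangentialVolume

variable {E : Type*} [NormedAddCommGroup E] [InnerProductSpace ℝ E] [FiniteDimensional ℝ E]
  [MeasurableSpace E] [BorelSpace E] {μ : Measure E} [μ.IsAddHaarMeasure] {K : Set E}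

theorem exists_measureReal_image_add_smul_le (hK : Convex ℝ K) (hc : IsCompact K)
    (hi : (interior K).Nonempty) {v : E → E} {L : NNReal} (hL : LipschitzOnWith L v K)
    (hv : IsTangentialOn v K) :
    ∃ C : ℝ, ∀ t : ℝ, μ.real ((fun x => x + t • v x) '' K) ≤
      (1 + C * t ^ 2) ^ Module.finrank ℝ E * μ.real K := by
  obtain ⟨a, ha⟩ := hi
  obtain ⟨r, hr, har⟩ := Metric.nhds_basis_closedBall.mem_iff.1 (mem_interior_iff_mem_nhds.1 ha)
  obtain ⟨B, hB⟩ := hc.exists_bound_of_continuousOn hL.continuousOn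
  have hB₀ : 0 ≤ B := (norm_nonneg _).trans (hB a (interior_subset ha))
  refine ⟨(L * B + 1) / r, fun t => ?_⟩
  obtain rfl | ht := eq_or_ne t 0
  · simp
  set κ := (L * B + 1) / r * t ^ 2 with hκ
  have image_subset : (fun x => x + t • v x) '' K ⊆ AffineMap.homothety a (1 + κ) '' K := by
    rintro _ ⟨x, hx, rfl⟩
    obtain ⟨y, hy, hxy⟩ := exists_mem_norm_add_smul_sub_le hK hc hL hB hv t hx
    refine mem_image_homothety_of_norm_sub_le hK har hy (by positivity) (hxy.trans ?_)
    have : κ * r = (L * B + 1) * t ^ 2 := by rw [hκ]; field_simp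
    rw [this]
    gcongr
    linarith
  calc μ.real ((fun x => x + t • v x) '' K)
      ≤ μ.real (AffineMap.homothety a (1 + κ) '' K) :=
        measureReal_mono image_subset (hc.image (AffineMap.homothety_continuous a _)).measure_ne_top
    _ = (1 + κ) ^ Module.finrank ℝ E * μ.real K := by
        rw [Measure.real, Measure.addHaar_image_homothety, ENNReal.toReal_mul,
          ENNReal.toReal_ofReal (abs_nonneg _), abs_of_nonneg (by positivity), Measure.real]

end TangentialVolume

section Couplings

variable {α β : Type*} [MeasurableSpace α] [MeasurableSpace β]

/-- The measure `π` is a coupling of its marginals `μ` and `ν`. -/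
structure IsCoupling (π : Measure (α × β)) (μ : Measure α) (ν : Measure β) : Prop where
  map_fst : π.map Prod.fst = μ
  map_snd : π.map Prod.snd = ν

theorem IsCoupling.map_left {γ : Type*} [MeasurableSpace γ] {π : Measure (α × β)} {μ : Measure α}
    {ν : Measure β} (hπ : IsCoupling π μ ν) {S : α → γ} (hS : AEMeasurable S μ) :
    IsCoupling (π.map fun z => (S z.1, z.2)) (μ.map S) ν := by
  rw [← hπ.map_fst] at hS
  have hfst : AEMeasurable (fun z => S z.1) π := hS.comp_measurable measurable_fst
  have hpair : AEMeasurable (fun z => (S z.1, z.2)) π := hfst.prodMk measurable_snd.aemeasurable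
  constructor
  · rw [AEMeasurable.map_map_of_aemeasurable measurable_fst.aemeasurable hpair, ← hπ.map_fst,
      AEMeasurable.map_map_of_aemeasurable hS measurable_fst.aemeasurable]
    rfl
  · rw [AEMeasurable.map_map_of_aemeasurable measurable_snd.aemeasurable hpair, ← hπ.map_snd]
    rfl

theorem IsCoupling.integrable_fst_add_snd {π : Measure (α × β)} {μ : Measure α} {ν : Measure β}
    (hπ : IsCoupling π μ ν) {f : α → ℝ} {g : β → ℝ} (hf : Integrable f μ) (hg : Integrable g ν) :
    Integrable (fun z => f z.1 + g z.2) π :=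
  ((hπ.map_fst ▸ hf).comp_measurable measurable_fst).add
    ((hπ.map_snd ▸ hg).comp_measurable measurable_snd)

theorem IsCoupling.integral_fst_add_snd {π : Measure (α × β)} {μ : Measure α} {ν : Measure β}
    (hπ : IsCoupling π μ ν) {f : α → ℝ} {g : β → ℝ} (hf : Integrable f μ) (hg : Integrable g ν) :
    ∫ z, (f z.1 + g z.2) ∂π = ∫ x, f x ∂μ + ∫ y, g y ∂ν := by
  obtain ⟨rfl, rfl⟩ := hπ
  rw [integral_map measurable_fst.aemeasurable hf.1, integral_map measurable_snd.aemeasurable hg.1]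
  exact integral_add (hf.comp_measurable measurable_fst) (hg.comp_measurable measurable_snd)

theorem IsCoupling.add {π π' : Measure (α × β)} {μ μ' : Measure α} {ν ν' : Measure β}
    (hπ : IsCoupling π μ ν) (hπ' : IsCoupling π' μ' ν') :
    IsCoupling (π + π') (μ + μ') (ν + ν') where
  map_fst := by rw [Measure.map_add _ _ measurable_fst, hπ.map_fst, hπ'.map_fst]
  map_snd := by rw [Measure.map_add _ _ measurable_snd, hπ.map_snd, hπ'.map_snd]

theorem isCoupling_map_diag (μ : Measure α) : IsCoupling (μ.map fun x => (x, x)) μ μ where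
  map_fst := by
    rw [Measure.map_map measurable_fst (by fun_prop)]
    exact Measure.map_id
  map_snd := by
    rw [Measure.map_map measurable_snd (by fun_prop)]
    exact Measure.map_id

theorem isCoupling_inv_smul_prod {μ : Measure α} {ν : Measure β} [IsFiniteMeasure μ]
    [IsFiniteMeasure ν] (hmass : μ univ = ν univ) (hμ : μ univ ≠ 0) :
    IsCoupling ((μ univ)⁻¹ • μ.prod ν) μ ν where
  map_fst := by
    rw [Measure.map_smul, Measure.map_fst_prod, smul_smul, ← hmass,
      ENNReal.inv_mul_cancel hμ (measure_ne_top μ univ), one_smul]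
  map_snd := by
    rw [Measure.map_smul, Measure.map_snd_prod, smul_smul,
      ENNReal.inv_mul_cancel hμ (measure_ne_top μ univ), one_smul]

theorem IsCoupling.measure_compl_prod_le {π : Measure (α × β)} {μ : Measure α} {ν : Measure β}
    (hπ : IsCoupling π μ ν) {s : Set α} {t : Set β} (hs : MeasurableSet s)
    (ht : MeasurableSet t) : π (s ×ˢ t)ᶜ ≤ μ sᶜ + ν tᶜ := by
  rw [← hπ.map_fst, ← hπ.map_snd, Measure.map_apply measurable_fst hs.compl,
    Measure.map_apply measurable_snd ht.compl]
  refine (measure_mono fun z hz => ?_).trans (measure_union_le _ _)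
  exact not_and_or.1 hz

/-- The transport plan `m` moves the mass distribution `μ` to `ν`, up to mass which is moved on from
a place to which it has been moved: `m` may have larger marginals than `μ` and `ν`, with the right
difference. (The difference is written without subtraction.) -/
def IsNetTransport (m : Measure (α × α)) (μ ν : Measure α) : Prop :=
  m.map Prod.snd + μ = m.map Prod.fst + ν

theorem IsCoupling.isNetTransport {m : Measure (α × α)} {μ ν : Measure α}
    (hm : IsCoupling m μ ν) : IsNetTransport m μ ν := by
  rw [IsNetTransport, hm.map_fst, hm.map_snd, add_comm]

theorem IsNetTransport.add {m m' : Measure (α × α)} {μ μ' ν ν' : Measure α}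
    (h : IsNetTransport m μ ν) (h' : IsNetTransport m' μ' ν') :
    IsNetTransport (m + m') (μ + μ') (ν + ν') := by
  rw [IsNetTransport, Measure.map_add _ _ measurable_fst, Measure.map_add _ _ measurable_snd,
    add_add_add_comm, h, h', add_add_add_comm]

end Couplings

section BoundedDensity

variable {α : Type*} [MeasurableSpace α] {μ μ' ν Q : Measure α}

/-- The measure `μ` has a bounded density with respect to `Q`. -/
def HasBoundedDensity (μ Q : Measure α) : Prop :=
  ∃ C : ℝ≥0, μ ≤ C • Q

theorem HasBoundedDensity.mono (h : HasBoundedDensity ν Q) (hμ : μ ≤ ν) :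
    HasBoundedDensity μ Q :=
  let ⟨C, hC⟩ := h
  ⟨C, hμ.trans hC⟩

theorem HasBoundedDensity.smul (h : HasBoundedDensity μ Q) {c : ℝ≥0∞} (hc : c ≠ ⊤) :
    HasBoundedDensity (c • μ) Q := by
  lift c to ℝ≥0 using hc
  obtain ⟨C, hC⟩ := h
  refine ⟨c * C, ?_⟩
  rw [mul_smul]
  exact smul_mono_right c hC

theorem HasBoundedDensity.trans (hμ : HasBoundedDensity μ ν) (hν : HasBoundedDensity ν Q) :
    HasBoundedDensity μ Q :=
  let ⟨_, hC⟩ := hμ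
  (hν.smul ENNReal.coe_ne_top).mono hC

theorem HasBoundedDensity.add (h : HasBoundedDensity μ Q) (h' : HasBoundedDensity μ' Q) :
    HasBoundedDensity (μ + μ') Q := by
  obtain ⟨C, hC⟩ := h
  obtain ⟨C', hC'⟩ := h'
  exact ⟨C + C', (add_le_add hC hC').trans_eq (add_smul C C' Q).symm⟩

theorem hasBoundedDensity_sum {ι : Type*} {s : Finset ι} {μ : ι → Measure α}
    (h : ∀ i ∈ s, HasBoundedDensity (μ i) Q) : HasBoundedDensity (∑ i ∈ s, μ i) Q :=
  Finset.sum_induction μ (HasBoundedDensity · Q) (fun _ _ => .add) ⟨0, by simp⟩ h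

theorem HasBoundedDensity.absolutelyContinuous (h : HasBoundedDensity μ Q) : μ ≪ Q :=
  let ⟨_, hC⟩ := h
  (Measure.absolutelyContinuous_of_le hC).trans Measure.smul_absolutelyContinuous

theorem HasBoundedDensity.restrict (h : HasBoundedDensity μ Q) {s : Set α}
    (hs : ∀ᵐ x ∂μ, x ∈ s) : HasBoundedDensity μ (Q.restrict s) := by
  obtain ⟨C, hC⟩ := h
  refine ⟨C, ?_⟩
  rw [← Measure.restrict_eq_self_of_ae_mem hs, ← Measure.restrict_smul]
  exact Measure.restrict_mono_measure hC s

end BoundedDensity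

section QuadraticCost

variable {E : Type*} [NormedAddCommGroup E] [MeasurableSpace E]

/-- The quadratic cost `∫ ‖x - y‖² dm(x, y)` of the transport plan `m`. -/
noncomputable def quadCost (m : Measure (E × E)) : ℝ≥0∞ :=
  ∫⁻ z, ‖z.1 - z.2‖ₑ ^ 2 ∂m

theorem quadCost_add (m m' : Measure (E × E)) :
    quadCost (m + m') = quadCost m + quadCost m' :=
  lintegral_add_measure _ _ _

theorem quadCost_smul (c : ℝ≥0∞) (m : Measure (E × E)) : quadCost (c • m) = c * quadCost m :=
  lintegral_smul_measure _ _

theorem quadCost_ne_top {m : Measure (E × E)} [IsFiniteMeasure m] {s : Set E}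
    (hs : Bornology.IsBounded s) (h₁ : ∀ᵐ z ∂m, z.1 ∈ s) (h₂ : ∀ᵐ z ∂m, z.2 ∈ s) :
    quadCost m ≠ ⊤ := by
  obtain ⟨D, hD⟩ := Metric.isBounded_iff.1 hs
  refine ne_top_of_le_ne_top (ENNReal.mul_ne_top (b := m univ) ?_ (measure_ne_top m univ)) <| calc
    quadCost m ≤ ∫⁻ _, ENNReal.ofReal D ^ 2 ∂m := by
      refine lintegral_mono_ae ?_
      filter_upwards [h₁, h₂] with z hz₁ hz₂
      rw [← ofReal_norm, ← dist_eq_norm]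
      gcongr
      exact hD hz₁ hz₂
    _ = ENNReal.ofReal D ^ 2 * m univ := lintegral_const _
  finiteness

variable [BorelSpace E] [SecondCountableTopology E]

theorem quadCost_map {α : Type*} [MeasurableSpace α] {m : Measure α} {g : α → E × E}
    (hg : Measurable g) : quadCost (m.map g) = ∫⁻ a, ‖(g a).1 - (g a).2‖ₑ ^ 2 ∂m :=
  lintegral_map (by fun_prop) hg

theorem quadCost_map_diag (μ : Measure E) : quadCost (μ.map fun x => (x, x)) = 0 := by
  simp [quadCost_map (g := fun x : E => (x, x)) (by fun_prop)]

theorem integrable_norm_sub_sq {m : Measure (E × E)} (hm : quadCost m ≠ ⊤) :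
    Integrable (fun z => ‖z.1 - z.2‖ ^ 2) m := by
  refine ⟨by fun_prop, ?_⟩
  simpa [HasFiniteIntegral, quadCost, lt_top_iff_ne_top] using hm

theorem integral_norm_sub_sq (m : Measure (E × E)) :
    ∫ z, ‖z.1 - z.2‖ ^ 2 ∂m = (quadCost m).toReal := by
  rw [integral_eq_lintegral_of_nonneg_ae (.of_forall fun _ => sq_nonneg _) (by fun_prop)]
  simp [quadCost, ENNReal.ofReal_pow]

-- Only the mass `t • m₁` moves: the coupling is `t • m` plus the diagonal image of `Q - t • m₁`.
theorem IsNetTransport.exists_isCoupling {Q Q' μ ν : Measure E} [IsFiniteMeasure Q]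
    [IsFiniteMeasure μ] {m : Measure (E × E)} (hm : IsNetTransport m μ ν) {C t : NNReal}
    (hC : m.map Prod.fst ≤ C • Q) (htC : t * C ≤ 1) (hQ' : Q' + t • μ = Q + t • ν) :
    ∃ γ, IsCoupling γ Q Q' ∧ quadCost γ = t * quadCost m := by
  set m₁ := m.map Prod.fst
  set m₂ := m.map Prod.snd
  have le_Q : t • m₁ ≤ Q := calc
    t • m₁ ≤ t • C • Q := smul_mono_right t hC
    _ = (t * C) • Q := smul_smul _ _ _
    _ ≤ (1 : NNReal) • Q := by gcongr
    _ = Q := one_smul _ _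
  have : IsFiniteMeasure (t • m₁) := ⟨(le_Q univ).trans_lt (measure_lt_top _ _)⟩
  have sub_add : Q - t • m₁ + t • m₁ = Q := Measure.sub_add_cancel_of_le le_Q
  have sub_add_snd : Q - t • m₁ + t • m₂ = Q' := by
    have add_eq : Q - t • m₁ + t • m₂ + t • μ = Q' + t • μ := by
      rw [add_assoc, ← smul_add, hm, smul_add, ← add_assoc, sub_add, hQ']
    rw [← Measure.add_sub_cancel (μ := _ + _) (ν := t • μ), add_eq, Measure.add_sub_cancel]
  have coupling : IsCoupling (t • m) (t • m₁) (t • m₂) :=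
    ⟨Measure.map_smul _ _ _, Measure.map_smul _ _ _⟩
  refine ⟨(Q - t • m₁).map (fun x => (x, x)) + t • m, ?_, ?_⟩
  · simpa only [sub_add, sub_add_snd] using (isCoupling_map_diag (Q - t • m₁)).add coupling
  · rw [quadCost_add, quadCost_map_diag, zero_add]
    exact quadCost_smul (t : ENNReal) m

end QuadraticCost

section ShortTransport

variable {E : Type*} [NormedAddCommGroup E] [NormedSpace ℝ E] [MeasurableSpace E]

/-- Up to an arbitrarily small part, the mass of `Q` lies in convex sets on which the density of `Q`
with respect to `vol` is bounded below. -/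
def HasConvexCores (Q vol : Measure E) : Prop :=
  ∀ ε : ℝ≥0∞, ε ≠ 0 → ∃ c, MeasurableSet c ∧ Convex ℝ c ∧ Q cᶜ ≤ ε ∧
    HasBoundedDensity (vol.restrict c) Q

theorem HasConvexCores.exists_measure_compl_lt {Q vol μ : Measure E}
    (hQ : HasConvexCores Q vol) (hμ : HasBoundedDensity μ Q) {ε : ℝ≥0∞} (hε : ε ≠ 0) :
    ∃ c, MeasurableSet c ∧ Convex ℝ c ∧ μ cᶜ < ε ∧ HasBoundedDensity (vol.restrict c) Q := by
  obtain ⟨C, hC⟩ := hμ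
  obtain ⟨δ, hδ, hδε⟩ := ENNReal.exists_nnreal_pos_mul_lt (a := C) ENNReal.coe_ne_top hε
  obtain ⟨c, hcm, hc, hQc, hdens⟩ := hQ δ (by simpa using hδ.ne')
  refine ⟨c, hcm, hc, ?_, hdens⟩
  calc μ cᶜ ≤ C * Q cᶜ := hC _
    _ ≤ C * δ := by gcongr
    _ < ε := by rwa [mul_comm]

variable [BorelSpace E]

section Chop

variable [SecondCountableTopology E]

theorem measurable_lineMap (s : ℝ) :
    Measurable fun z : E × E => AffineMap.lineMap (k := ℝ) z.1 z.2 s := by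
  simp only [AffineMap.lineMap_apply, vsub_eq_sub, vadd_eq_add]
  fun_prop

theorem measurable_lineMap_prodMk (s t : ℝ) :
    Measurable fun z : E × E =>
      (AffineMap.lineMap (k := ℝ) z.1 z.2 s, AffineMap.lineMap (k := ℝ) z.1 z.2 t) :=
  (measurable_lineMap s).prodMk (measurable_lineMap t)

/-- Every move of the transport plan `m` is replaced by `N` consecutive moves, along `N` pieces of
equal length of the segment from its start to its end. This divides the quadratic cost by `N`. -/
noncomputable def chop (N : ℕ) (m : Measure (E × E)) : Measure (E × E) :=
  ∑ k ∈ Finset.range N, m.map fun z =>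
    (AffineMap.lineMap z.1 z.2 (k / N : ℝ), AffineMap.lineMap z.1 z.2 ((k + 1 : ℕ) / N : ℝ))

theorem map_fst_chop (N : ℕ) (m : Measure (E × E)) :
    (chop N m).map Prod.fst =
      ∑ k ∈ Finset.range N, m.map fun z => AffineMap.lineMap z.1 z.2 (k / N : ℝ) := by
  rw [chop, Measure.map_finset_sum measurable_fst.aemeasurable]
  exact Finset.sum_congr rfl fun k _ =>
    Measure.map_map measurable_fst (measurable_lineMap_prodMk _ _)

theorem map_snd_chop (N : ℕ) (m : Measure (E × E)) :
    (chop N m).map Prod.snd =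
      ∑ k ∈ Finset.range N, m.map fun z => AffineMap.lineMap z.1 z.2 ((k + 1 : ℕ) / N : ℝ) := by
  rw [chop, Measure.map_finset_sum measurable_snd.aemeasurable]
  exact Finset.sum_congr rfl fun k _ =>
    Measure.map_map measurable_snd (measurable_lineMap_prodMk _ _)

theorem isNetTransport_chop {N : ℕ} (hN : N ≠ 0) (m : Measure (E × E)) :
    IsNetTransport (chop N m) (m.map Prod.fst) (m.map Prod.snd) := by
  have map_zero : m.map (fun z => AffineMap.lineMap z.1 z.2 ((0 : ℕ) / N : ℝ)) =
      m.map Prod.fst := congrArg m.map (funext fun z => by simp)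
  have map_last : m.map (fun z => AffineMap.lineMap z.1 z.2 (N / N : ℝ)) = m.map Prod.snd :=
    congrArg m.map (funext fun z => by simp [hN])
  rw [IsNetTransport, map_fst_chop, map_snd_chop, ← map_zero, ← map_last,
    ← Finset.sum_range_succ' (fun k : ℕ => m.map fun z => AffineMap.lineMap z.1 z.2 (k / N : ℝ)),
    ← Finset.sum_range_succ (fun k : ℕ => m.map fun z => AffineMap.lineMap z.1 z.2 (k / N : ℝ))]

theorem quadCost_chop {N : ℕ} (hN : N ≠ 0) (m : Measure (E × E)) :
    quadCost (chop N m) = (N : ℝ≥0∞)⁻¹ * quadCost m := by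
  have hN' : (N : ℝ) ≠ 0 := Nat.cast_ne_zero.2 hN
  have piece (k : ℕ) (z : E × E) : ‖AffineMap.lineMap (k := ℝ) z.1 z.2 (k / N : ℝ) -
      AffineMap.lineMap (k := ℝ) z.1 z.2 ((k + 1 : ℕ) / N : ℝ)‖ₑ ^ 2 =
        (N : ℝ≥0∞)⁻¹ ^ 2 * ‖z.1 - z.2‖ₑ ^ 2 := by
    rw [← edist_eq_enorm_sub, edist_nndist, nndist_lineMap_lineMap, ENNReal.coe_mul,
      ← edist_nndist, ← edist_nndist, edist_eq_enorm_sub, edist_eq_enorm_sub, ← sub_div,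
      Nat.cast_succ, sub_add_cancel_left, neg_div, enorm_neg, one_div, enorm_inv hN',
      Real.enorm_natCast, mul_pow]
  have cost_piece (k : ℕ) : quadCost (m.map fun z => (AffineMap.lineMap z.1 z.2 (k / N : ℝ),
      AffineMap.lineMap z.1 z.2 ((k + 1 : ℕ) / N : ℝ))) = (N : ℝ≥0∞)⁻¹ ^ 2 * quadCost m := by
    rw [quadCost_map (measurable_lineMap_prodMk _ _)]
    simp_rw [piece]
    exact lintegral_const_mul _ (by fun_prop)
  calc quadCost (chop N m) = ∑ k ∈ Finset.range N, (N : ℝ≥0∞)⁻¹ ^ 2 * quadCost m := by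
        rw [quadCost, chop, lintegral_finsetSum_measure]
        exact Finset.sum_congr rfl fun k _ => cost_piece k
    _ = N * (N : ℝ≥0∞)⁻¹ * ((N : ℝ≥0∞)⁻¹ * quadCost m) := by
        rw [Finset.sum_const, Finset.card_range, nsmul_eq_mul]
        ring
    _ = (N : ℝ≥0∞)⁻¹ * quadCost m := by
        rw [ENNReal.mul_inv_cancel (by simpa using hN) (by simp), one_mul]

theorem IsCoupling.isNetTransport_restrict_compl_add_chop {π : Measure (E × E)} {μ ν : Measure E}
    (hπ : IsCoupling π μ ν) {s : Set (E × E)} (hs : MeasurableSet s) {N : ℕ} (hN : N ≠ 0) :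
    IsNetTransport (π.restrict sᶜ + chop N (π.restrict s)) μ ν := by
  have := (IsCoupling.mk rfl rfl : IsCoupling (π.restrict sᶜ) _ _).isNetTransport.add
    (isNetTransport_chop hN (π.restrict s))
  rwa [← Measure.map_add _ _ measurable_fst, ← Measure.map_add _ _ measurable_snd,
    Measure.restrict_compl_add_restrict hs, hπ.map_fst, hπ.map_snd] at this

theorem hasBoundedDensity_map_fst_chop {m : Measure (E × E)} {Q : Measure E}
    (hm : HasBoundedDensity (m.map Prod.fst) Q)
    (h : ∀ s ∈ Ioo (0 : ℝ) 1, HasBoundedDensity (m.map fun z => AffineMap.lineMap z.1 z.2 s) Q)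
    (N : ℕ) : HasBoundedDensity ((chop N m).map Prod.fst) Q := by
  rw [map_fst_chop]
  refine hasBoundedDensity_sum fun k hk => ?_
  rcases k.eq_zero_or_pos with rfl | hk₀
  · simpa using hm
  have hkN : (k : ℝ) < N := by exact_mod_cast Finset.mem_range.1 hk
  have hk₀ : (0 : ℝ) < k := by exact_mod_cast hk₀
  exact h _ ⟨div_pos hk₀ (hk₀.trans hkN), (div_lt_one (hk₀.trans hkN)).2 hkN⟩

end Chop

variable [FiniteDimensional ℝ E] {vol : Measure E} [vol.IsAddHaarMeasure] {Q μ ν : Measure E}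
  [IsFiniteMeasure μ] [IsFiniteMeasure ν]

theorem hasBoundedDensity_map_lineMap_prod (hν : HasBoundedDensity ν vol) {s : ℝ} (hs : 0 < s) :
    HasBoundedDensity ((μ.prod ν).map fun z => AffineMap.lineMap z.1 z.2 s) vol := by
  obtain ⟨C, hC⟩ := hν
  have hs' : ENNReal.ofReal (s ^ Module.finrank ℝ E) ≠ 0 :=
    (ENNReal.ofReal_pos.2 (by positivity)).ne'
  -- Given the first point, the law of the second one is contracted by the ratio `s`.
  have slice_le (A : Set E) (x : E) : ν {y | AffineMap.lineMap x y s ∈ A} ≤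
      C * (ENNReal.ofReal (s ^ Module.finrank ℝ E))⁻¹ * vol A := calc
    ν {y | AffineMap.lineMap x y s ∈ A} ≤ C * vol {y | AffineMap.lineMap x y s ∈ A} := hC _
    _ ≤ C * ((ENNReal.ofReal (s ^ Module.finrank ℝ E))⁻¹ * vol A) := by
      gcongr
      rw [← ENNReal.div_eq_inv_mul,
        ENNReal.le_div_iff_mul_le (.inl hs') (.inl ENNReal.ofReal_ne_top), mul_comm,
        ← abs_of_pos (pow_pos hs _), ← Measure.addHaar_image_homothety vol x]
      refine measure_mono ?_
      rintro _ ⟨y, hy, rfl⟩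
      rwa [AffineMap.homothety_eq_lineMap]
    _ = C * (ENNReal.ofReal (s ^ Module.finrank ℝ E))⁻¹ * vol A := (mul_assoc _ _ _).symm
  refine HasBoundedDensity.smul (μ := vol) (c := C * (ENNReal.ofReal (s ^ Module.finrank ℝ E))⁻¹ *
    μ univ) ⟨1, by simp⟩ (ENNReal.mul_ne_top (ENNReal.mul_ne_top ENNReal.coe_ne_top
      (ENNReal.inv_ne_top.2 hs')) (measure_ne_top _ _)) |>.mono (Measure.le_iff.2 fun A hA => ?_)
  rw [Measure.map_apply (measurable_lineMap s) hA, Measure.prod_apply (measurable_lineMap s hA)]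
  refine (lintegral_mono (slice_le A)).trans_eq ?_
  rw [lintegral_const, Measure.smul_apply, smul_eq_mul]
  ring

theorem hasBoundedDensity_map_lineMap_prod_restrict (hν : HasBoundedDensity ν vol) {s : ℝ}
    (hs : s ∈ Ioc 0 1) {c : Set E} (hc : Convex ℝ c) (hcm : MeasurableSet c) :
    HasBoundedDensity (((μ.prod ν).restrict (c ×ˢ c)).map fun z => AffineMap.lineMap z.1 z.2 s)
      (vol.restrict c) := by
  refine ((hasBoundedDensity_map_lineMap_prod hν hs.1).mono
    (Measure.map_mono Measure.restrict_le_self (measurable_lineMap s))).restrict ?_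
  refine (ae_map_iff (measurable_lineMap s).aemeasurable hcm).2 ?_
  filter_upwards [ae_restrict_mem (hcm.prod hcm)] with z hz
  exact hc.lineMap_mem hz.1 hz.2 (Ioc_subset_Icc_self hs)

-- The part of the independent coupling of `μ` and `ν` inside a convex core of `Q` is chopped into
-- short moves, and the rest is small.
theorem exists_isNetTransport_quadCost_le (hμ : HasBoundedDensity μ Q)
    (hν : HasBoundedDensity ν Q) (hQ : HasBoundedDensity Q vol) (hcore : HasConvexCores Q vol)
    (hmass : μ univ = ν univ) (hcost : quadCost (μ.prod ν) ≠ ⊤) {ε : ℝ≥0∞} (hε : ε ≠ 0) :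
    ∃ m, HasBoundedDensity (m.map Prod.fst) Q ∧ IsNetTransport m μ ν ∧ quadCost m ≤ ε := by
  rcases eq_or_ne (μ univ) 0 with hμ0 | hμ0
  · obtain rfl : μ = 0 := Measure.measure_univ_eq_zero.1 hμ0
    obtain rfl : ν = 0 := Measure.measure_univ_eq_zero.1 (hmass ▸ hμ0)
    exact ⟨0, ⟨0, by simp⟩, by simp [IsNetTransport], by simp [quadCost]⟩
  set π := (μ univ)⁻¹ • μ.prod ν with hπ
  have coupling : IsCoupling π μ ν := isCoupling_inv_smul_prod hmass hμ0
  have inv_ne_top : (μ univ)⁻¹ ≠ ⊤ := ENNReal.inv_ne_top.2 hμ0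
  have cost_ne_top : quadCost π ≠ ⊤ := by
    rw [hπ, quadCost_smul]
    exact ENNReal.mul_ne_top inv_ne_top hcost
  have hε2 : ε / 2 ≠ 0 := (ENNReal.half_pos hε).ne'
  obtain ⟨δ, hδ, cost_lt⟩ := exists_pos_setLIntegral_lt_of_measure_lt cost_ne_top hε2
  obtain ⟨c, hcm, hc, compl_lt, hdens⟩ := hcore.exists_measure_compl_lt (hμ.add hν) hδ.ne'
  obtain ⟨N, hN, cost_inv_lt⟩ := ENNReal.exists_nat_pos_inv_mul_lt cost_ne_top hε2
  set inner := π.restrict (c ×ˢ c)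
  set outer := π.restrict (c ×ˢ c)ᶜ
  have map_fst_le {m} (hm : m ≤ π) : HasBoundedDensity (m.map Prod.fst) Q :=
    hμ.mono ((Measure.map_mono hm measurable_fst).trans_eq coupling.map_fst)
  refine ⟨outer + chop N inner, ?_,
    coupling.isNetTransport_restrict_compl_add_chop (hcm.prod hcm) hN.ne', ?_⟩
  · rw [Measure.map_add _ _ measurable_fst]
    refine (map_fst_le Measure.restrict_le_self).add (hasBoundedDensity_map_fst_chop
      (map_fst_le Measure.restrict_le_self) (fun s hs => ?_) N)
    have := hasBoundedDensity_map_lineMap_prod_restrict (μ := μ) (hν.trans hQ)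
      (Ioo_subset_Ioc_self hs) hc hcm
    simpa only [inner, hπ, Measure.restrict_smul, Measure.map_smul] using
      (this.trans hdens).smul inv_ne_top
  · rw [quadCost_add, quadCost_chop hN.ne', ← ENNReal.add_halves ε]
    refine add_le_add (cost_lt _ ?_).le (le_trans ?_ cost_inv_lt.le)
    · exact (coupling.measure_compl_prod_le hcm hcm).trans_lt compl_lt
    · gcongr
      exact lintegral_mono' Measure.restrict_le_self le_rfl

end ShortTransport

section WithDensityOfReal

variable {α : Type*} [MeasurableSpace α] {μ : Measure α} {f g : α → ℝ} {s : Set α}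

theorem hasBoundedDensity_withDensity_ofReal {C : ℝ} (hfg : ∀ᵐ x ∂μ, f x ≤ C * g x)
    (hg : ∀ᵐ x ∂μ, 0 ≤ g x) : HasBoundedDensity (μ.withDensity fun x => ENNReal.ofReal (f x))
      (μ.withDensity fun x => ENNReal.ofReal (g x)) := by
  refine ⟨C.toNNReal, ?_⟩
  change _ ≤ ENNReal.ofReal C • (_ : Measure α)
  rw [← withDensity_smul' _ _ ENNReal.ofReal_ne_top]
  refine withDensity_mono ?_
  filter_upwards [hfg, hg] with x hfg hg
  rw [Pi.smul_apply, smul_eq_mul, ← ENNReal.ofReal_mul' hg]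
  exact ENNReal.ofReal_le_ofReal hfg

theorem hasBoundedDensity_withDensity_ofReal_of_le {C : ℝ} (hf : ∀ᵐ x ∂μ, f x ≤ C) :
    HasBoundedDensity (μ.withDensity fun x => ENNReal.ofReal (f x)) μ := by
  refine ⟨C.toNNReal, ?_⟩
  change _ ≤ ENNReal.ofReal C • (_ : Measure α)
  rw [← withDensity_const]
  exact withDensity_mono (hf.mono fun x hx => ENNReal.ofReal_le_ofReal hx)

theorem hasBoundedDensity_restrict_withDensity_ofReal {a : ℝ} (ha : 0 < a)
    (hs : MeasurableSet s) (hf : ∀ x ∈ s, a ≤ f x) :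
    HasBoundedDensity (μ.restrict s) (μ.withDensity fun x => ENNReal.ofReal (f x)) := by
  refine ⟨a⁻¹.toNNReal, ?_⟩
  change _ ≤ ENNReal.ofReal a⁻¹ • (_ : Measure α)
  rw [← withDensity_smul' _ _ ENNReal.ofReal_ne_top, ← withDensity_indicator_one hs]
  refine withDensity_mono (.of_forall fun x => indicator_le (fun x hx => ?_) x)
  rw [Pi.smul_apply, smul_eq_mul, ← ENNReal.ofReal_mul (by positivity),
    Pi.one_apply, ENNReal.one_le_ofReal, ← div_eq_inv_mul, one_le_div ha]
  exact hf x hx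

theorem withDensity_ofReal_univ_eq_of_integral_eq_zero (hf : Integrable f μ)
    (hf₀ : ∫ x, f x ∂μ = 0) : (μ.withDensity fun x => ENNReal.ofReal (-f x)) univ =
      (μ.withDensity fun x => ENNReal.ofReal (f x)) univ := by
  have neg_lt_top : ∫⁻ x, ENNReal.ofReal (-f x) ∂μ < ⊤ := hf.neg.lintegral_lt_top
  rw [withDensity_apply _ .univ, withDensity_apply _ .univ, Measure.restrict_univ, eq_comm,
    ← ENNReal.toReal_eq_toReal_iff' hf.lintegral_lt_top.ne neg_lt_top.ne, ← sub_eq_zero]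
  exact (integral_eq_lintegral_pos_part_sub_lintegral_neg_part hf).symm.trans hf₀

theorem withDensity_ofReal_add_mul {t : ℝ≥0} (hf : AEMeasurable f μ) (hg : AEMeasurable g μ)
    (hf₀ : ∀ᵐ x ∂μ, 0 ≤ f x) (hfg₀ : ∀ᵐ x ∂μ, 0 ≤ f x + t * g x) :
    (μ.withDensity fun x => ENNReal.ofReal (f x + t * g x)) +
        t • (μ.withDensity fun x => ENNReal.ofReal (-g x)) =
      (μ.withDensity fun x => ENNReal.ofReal (f x)) +
        t • (μ.withDensity fun x => ENNReal.ofReal (g x)) := by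
  ext s hs
  simp only [Measure.add_apply, Measure.smul_apply, withDensity_apply _ hs, ENNReal.smul_def,
    smul_eq_mul]
  rw [← lintegral_const_mul'' _ (by fun_prop), ← lintegral_const_mul'' _ (by fun_prop),
    ← lintegral_add_left' (by fun_prop), ← lintegral_add_left' (by fun_prop)]
  refine lintegral_congr_ae (ae_restrict_of_ae ?_)
  filter_upwards [hf₀, hfg₀] with x hf₀ hfg₀
  have t_nonneg : (0 : ℝ) ≤ t := t.2
  rw [← ENNReal.ofReal_coe_nnreal, ← ENNReal.ofReal_mul t_nonneg, ← ENNReal.ofReal_mul t_nonneg]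
  rcases le_total 0 (g x) with h | h
  · rw [ENNReal.ofReal_of_nonpos (p := t * -g x) (by nlinarith), add_zero,
      ENNReal.ofReal_add hf₀ (by positivity)]
  · rw [ENNReal.ofReal_of_nonpos (p := t * g x) (by nlinarith), add_zero,
      ← ENNReal.ofReal_add hfg₀ (by nlinarith)]
    ring_nf

end WithDensityOfReal

theorem exists_isCompact_convex_between {E : Type*} [NormedAddCommGroup E] [NormedSpace ℝ E]
    [FiniteDimensional ℝ E] {K U : Set E} (hK : IsCompact K) (hU : Convex ℝ U) (hUo : IsOpen U)
    (hKU : K ⊆ U) : ∃ c, IsCompact c ∧ Convex ℝ c ∧ K ⊆ c ∧ c ⊆ U := by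
  classical
  have : ∀ x ∈ K, ∃ u : Finset E,
      convexHull ℝ (u : Set E) ∈ 𝓝 x ∧ convexHull ℝ (u : Set E) ⊆ U := fun x hx => by
    obtain ⟨u, hxu, huU⟩ := (convex_singleton (𝕜 := ℝ)
      x).exists_subset_interior_convexHull_finset_of_isCompact isCompact_singleton
      (by simpa using hUo.mem_nhds (hKU hx))
    exact ⟨u, mem_interior_iff_mem_nhds.1 (singleton_subset_iff.1 hxu), huU⟩
  choose! u mem_nhds subset_U using this
  obtain ⟨t, htK, hKt⟩ := hK.elim_nhds_subcover _ mem_nhds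
  have finite_vertices : (⋃ x ∈ t, (u x : Set E)).Finite :=
    t.finite_toSet.biUnion fun x _ => (u x).finite_toSet
  refine ⟨convexHull ℝ (⋃ x ∈ t, (u x : Set E)), finite_vertices.isCompact_convexHull ℝ,
    convex_convexHull ℝ _, hKt.trans (iUnion₂_subset fun x hx => convexHull_mono
      (subset_biUnion_of_mem (u := fun x => (u x : Set E)) hx)), convexHull_min ?_ hU⟩
  exact iUnion₂_subset fun x hx => (subset_convexHull ℝ _).trans (subset_U x (htK x hx))

section FirstOrder

variable {E F : Type*} [NormedAddCommGroup E] [NormedSpace ℝ E]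
  [NormedAddCommGroup F] [NormedSpace ℝ F] {s : Set E} {x y : E}

theorem hasFDerivWithinAt_apply_sub_le_sub_of_convexOn {Φ : E → ℝ} {Φ' : E →L[ℝ] ℝ}
    (hΦ : ConvexOn ℝ s Φ) (hΦ' : HasFDerivWithinAt Φ Φ' s x) (hx : x ∈ s) (hy : y ∈ s) :
    Φ' (y - x) ≤ Φ y - Φ x := by
  set l : ℝ →ᵃ[ℝ] E := AffineMap.lineMap x y
  have l_zero : l 0 = x := AffineMap.lineMap_apply_zero x y
  have mapsTo : MapsTo l (Icc 0 1) s := fun t ht => hΦ.1.lineMap_mem hx hy ht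
  have convexOn : ConvexOn ℝ (Icc 0 1) (Φ ∘ l) :=
    (hΦ.comp_affineMap l).subset mapsTo (convex_Icc 0 1)
  have hasDerivWithinAt : HasDerivWithinAt (Φ ∘ l) (Φ' (y - x)) (Icc 0 1) 0 :=
    HasFDerivWithinAt.comp_hasDerivWithinAt 0 (by rwa [l_zero])
      AffineMap.hasDerivWithinAt_lineMap mapsTo
  simpa [slope_def_field, l] using convexOn.le_slope_of_hasDerivWithinAt
    (left_mem_Icc.2 zero_le_one) (right_mem_Icc.2 zero_le_one) one_pos hasDerivWithinAt

theorem norm_sub_sub_fderiv_apply_le_of_lipschitzOnWith {f : E → F} {f' : E → E →L[ℝ] F}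
    {L : NNReal} (hs : Convex ℝ s) (hf : ∀ z ∈ s, HasFDerivWithinAt f (f' z) s z)
    (hL : LipschitzOnWith L f' s) (hx : x ∈ s) (hy : y ∈ s) :
    ‖f y - f x - f' x (y - x)‖ ≤ L * ‖y - x‖ ^ 2 := by
  have segment_subset : segment ℝ x y ⊆ s := hs.segment_subset hx hy
  have norm_sub_le : ∀ z ∈ segment ℝ x y, ‖f' z - f' x‖ ≤ L * ‖y - x‖ := by
    intro z hz
    rw [← dist_eq_norm, ← dist_eq_norm]
    refine (hL.dist_le_mul z (segment_subset hz) x hx).trans ?_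
    gcongr
    rw [dist_comm, dist_comm y]
    linarith [dist_add_dist_of_mem_segment hz, dist_nonneg (x := z) (y := y)]
  refine ((convex_segment x y).norm_image_sub_le_of_norm_hasFDerivWithin_le'
    (fun z hz => (hf z (segment_subset hz)).mono segment_subset) norm_sub_le
    (left_mem_segment ℝ x y) (right_mem_segment ℝ x y)).trans_eq ?_
  ring

end FirstOrder

section InnerProduct

variable {E : Type*} [NormedAddCommGroup E] [InnerProductSpace ℝ E]

theorem hasFDerivWithinAt_norm_sq_div_two (x : E) (s : Set E) :
    HasFDerivWithinAt (fun y => ‖y‖ ^ 2 / 2) (innerSL ℝ x) s x := by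
  simp only [div_eq_mul_inv]
  exact ((hasStrictFDerivAt_norm_sq x).hasFDerivAt.hasFDerivWithinAt.mul_const
    (2 : ℝ)⁻¹).congr_fderiv (by ext w; simp)

theorem norm_sub_sq_eq_potential_add (x y z : E) (a b : ℝ) :
    ‖y - z‖ ^ 2 = ‖x - z‖ ^ 2 - (‖x‖ ^ 2 - 2 * a) + (‖y‖ ^ 2 - 2 * b) +
      2 * (b - a - ⟪z, y - x⟫) := by
  rw [norm_sub_sq_real, norm_sub_sq_real, inner_sub_right, real_inner_comm x z,
    real_inner_comm y z]
  ring

end InnerProduct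

theorem hasDerivAt_of_eventually_le_of_eventually_le {G : ℝ → ℝ} {A I a : ℝ}
    (lower : ∀ᶠ t in 𝓝 a, A + (t - a) * I ≤ G t)
    (upper : ∀ ε > 0, ∀ᶠ t in 𝓝 a, G t ≤ A + (t - a) * I + ε * |t - a|) :
    HasDerivAt G I a := by
  have value : G a = A := by
    refine le_antisymm ?_ ?_
    · simpa using (upper 1 one_pos).self_of_nhds
    · simpa using lower.self_of_nhds
  rw [hasDerivAt_iff_isLittleO, Asymptotics.isLittleO_iff]
  intro ε hε
  filter_upwards [lower, upper ε hε] with t hlower hupper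
  rw [value, smul_eq_mul, Real.norm_of_nonneg (by linarith), Real.norm_eq_abs]
  linarith

namespace SampleSpace

variable {d : ℕ}

section Geometry

variable (X : SampleSpace d)

theorem convex_cover : Convex ℝ X.cover := by
  cases X with
  | convexBody K _ hK _ => exact hK
  | torus => exact convex_univ

theorem isClosed_cover : IsClosed X.cover := by
  cases X with
  | convexBody K hK _ _ => exact hK.isClosed
  | torus => exact isClosed_univ

theorem nonempty_interior_cover : (interior X.cover).Nonempty := by
  cases X with
  | convexBody K _ _ hK => exact hK
  | torus => simp [cover]

theorem nonempty_cover : X.cover.Nonempty := X.nonempty_interior_cover.mono interior_subset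

theorem uniqueDiffOn_cover : UniqueDiffOn ℝ X.cover :=
  uniqueDiffOn_convex X.convex_cover X.nonempty_interior_cover

theorem cell_torus : (torus : SampleSpace d).cell =
    ZSpan.fundamentalDomain (EuclideanSpace.basisFun (Fin d) ℝ).toBasis := by
  ext x
  simp [cell, ZSpan.fundamentalDomain]

theorem convex_cell : Convex ℝ X.cell := by
  cases X with
  | convexBody K _ hK _ => exact hK
  | torus =>
    intro x hx y hy a b ha hb hab i
    exact convex_Ico (0 : ℝ) 1 (hx i) (hy i) ha hb hab

theorem measurableSet_cell : MeasurableSet X.cell := by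
  cases X with
  | convexBody K hK _ _ => exact hK.measurableSet
  | torus =>
    rw [cell_torus]
    exact ZSpan.fundamentalDomain_measurableSet _

theorem isBounded_cell : Bornology.IsBounded X.cell := by
  cases X with
  | convexBody K hK _ _ => exact hK.isBounded
  | torus =>
    rw [cell_torus]
    exact ZSpan.fundamentalDomain_isBounded _

theorem cell_subset_cover : X.cell ⊆ X.cover := by
  cases X with
  | convexBody K _ _ _ => exact subset_rfl
  | torus => exact subset_univ _

theorem isCompact_closure_cell : IsCompact (closure X.cell) := X.isBounded_cell.isCompact_closure

theorem closure_cell_subset_cover : closure X.cell ⊆ X.cover :=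
  closure_minimal X.cell_subset_cover X.isClosed_cover

theorem ae_mem_interior_cell : ∀ᵐ x ∂(volume.restrict X.cell), x ∈ interior X.cell := by
  have hfrontier : ∀ᵐ x : 𝔼 d, x ∉ frontier X.cell :=
    measure_eq_zero_iff_ae_notMem.1 (X.convex_cell.addHaar_frontier volume)
  filter_upwards [ae_restrict_mem X.measurableSet_cell, ae_restrict_of_ae hfrontier]
    with x hx hx'
  by_contra hint
  exact hx' ⟨subset_closure hx, hint⟩

instance : IsFiniteMeasure (volume.restrict X.cell) :=
  isFiniteMeasure_restrict.2 X.isBounded_cell.measure_lt_top.ne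

end Geometry

section Periods

variable (X : SampleSpace d)

theorem periods_torus : (torus : SampleSpace d).periods =
    Submodule.span ℤ (range (EuclideanSpace.basisFun (Fin d) ℝ).toBasis) := by
  ext x
  rw [SetLike.mem_coe, Module.Basis.mem_span_iff_repr_mem]
  simp [periods, eq_comm]

/-- The periods of `X` as a group; its action on `ℝᵈ` has the quotient `Ω`. -/
def periodGroup : AddSubgroup (𝔼 d) where
  carrier := X.periods
  zero_mem' := by
    cases X with
    | convexBody K _ _ _ => exact mem_singleton _
    | torus => rw [periods_torus]; exact zero_mem _
  add_mem' {k l} hk hl := by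
    cases X with
    | convexBody K _ _ _ => rw [mem_singleton_iff.1 hk, zero_add]; exact hl
    | torus => rw [periods_torus] at *; exact add_mem hk hl
  neg_mem' {k} hk := by
    cases X with
    | convexBody K _ _ _ => rw [mem_singleton_iff.1 hk, neg_zero]; exact mem_singleton _
    | torus => rw [periods_torus] at *; exact neg_mem hk

instance : Countable X.periodGroup := by
  cases X with
  | convexBody K _ _ _ => exact (countable_singleton (0 : 𝔼 d)).to_subtype
  | torus =>
    have hspan : Countable (Submodule.span ℤ
        (range (EuclideanSpace.basisFun (Fin d) ℝ).toBasis)) :=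
      TopologicalSpace.separableSpace_iff_countable.1 inferInstance
    change Countable (torus : SampleSpace d).periods
    rw [periods_torus]
    exact hspan

instance : Countable X.periods := inferInstanceAs (Countable X.periodGroup)

instance : Nonempty X.periods := inferInstanceAs (Nonempty X.periodGroup)

theorem zero_mem_periods : 0 ∈ X.periods := X.periodGroup.zero_mem

theorem neg_mem_periods {k : 𝔼 d} (hk : k ∈ X.periods) : -k ∈ X.periods :=
  X.periodGroup.neg_mem hk

theorem add_mem_cover_iff {x k : 𝔼 d} (hk : k ∈ X.periods) : x + k ∈ X.cover ↔ x ∈ X.cover := by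
  cases X with
  | convexBody K _ _ _ => rw [mem_singleton_iff.1 hk, add_zero]
  | torus => exact Iff.rfl

theorem eq_zero_of_mem_cell_of_add_mem_cell {x k : 𝔼 d} (hx : x ∈ X.cell) (hk : k ∈ X.periods)
    (hxk : x + k ∈ X.cell) : k = 0 := by
  cases X with
  | convexBody K _ _ _ => exact hk
  | torus =>
    ext i
    obtain ⟨m, hm⟩ := hk i
    obtain ⟨hx₀, hx₁⟩ := hx i
    obtain ⟨hxk₀, hxk₁⟩ := hxk i
    rw [PiLp.add_apply, hm] at hxk₀ hxk₁
    have hm₁ : m < 1 := by exact_mod_cast (by linarith : (m : ℝ) < 1)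
    have hm₂ : -1 < m := by exact_mod_cast (by linarith : (-1 : ℝ) < m)
    have hm₀ : m = 0 := by omega
    simp [hm, hm₀]

/-- A choice, for each point of the cover, of a representative in the cell: the identity for a
convex body and the coordinatewise fractional part for the torus. -/
noncomputable def reduce : (X : SampleSpace d) → 𝔼 d → 𝔼 d
  | convexBody _ _ _ _ => id
  | torus => fun x => WithLp.toLp 2 fun i => Int.fract (x i)

theorem measurable_reduce : Measurable X.reduce := by
  cases X with
  | convexBody K _ _ _ => exact measurable_id
  | torus =>
    refine (PiLp.continuous_toLp 2 _).measurable.comp (measurable_pi_lambda _ fun i => ?_)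
    exact measurable_fract.comp (EuclideanSpace.proj i).continuous.measurable

theorem reduce_mem_cell {x : 𝔼 d} (hx : x ∈ X.cover) : X.reduce x ∈ X.cell := by
  cases X with
  | convexBody K _ _ _ => exact hx
  | torus => exact fun i => ⟨Int.fract_nonneg _, Int.fract_lt_one _⟩

theorem exists_reduce_eq_add (x : 𝔼 d) : ∃ k ∈ X.periods, X.reduce x = x + k := by
  cases X with
  | convexBody K _ _ _ => exact ⟨0, mem_singleton _, (add_zero x).symm⟩
  | torus =>
    refine ⟨WithLp.toLp 2 fun i => -(⌊x i⌋ : ℝ), fun i => ⟨-⌊x i⌋, by simp⟩, ?_⟩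
    ext i
    simp [reduce, Int.fract, sub_eq_add_neg]

instance : VAddInvariantMeasure X.periodGroup (𝔼 d) (volume.restrict X.cover) where
  measure_preimage_vadd k s _ := by
    cases X with
    | convexBody K _ _ _ =>
      have hk : (k : 𝔼 d) = 0 := k.2
      simp [AddSubgroup.vadd_def, hk]
    | torus =>
      simp only [cover, Measure.restrict_univ]
      exact measure_preimage_add volume (k : 𝔼 d) s

theorem isAddFundamentalDomain {s : Set (𝔼 d)} (hs : NullMeasurableSet s (volume.restrict X.cover))
    (hcover : ∀ x ∈ X.cover, ∃ k ∈ X.periods, x + k ∈ s)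
    (hinj : ∀ x ∈ s, ∀ k ∈ X.periods, x + k ∈ s → k = 0) :
    IsAddFundamentalDomain X.periodGroup s (volume.restrict X.cover) := by
  refine .mk'' hs ?_ (fun k hk => ?_) fun k =>
    (measurePreserving_vadd k _).quasiMeasurePreserving
  · filter_upwards [ae_restrict_mem X.isClosed_cover.measurableSet] with x hx
    obtain ⟨k, hk, hxk⟩ := hcover x hx
    exact ⟨⟨k, hk⟩, by rwa [AddSubgroup.vadd_def, vadd_eq_add, add_comm]⟩
  · refine Disjoint.aedisjoint (Set.disjoint_left.2 ?_)
    rintro _ ⟨x, hx, rfl⟩ hkx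
    simp only [AddSubgroup.vadd_def, vadd_eq_add] at hkx
    exact hk (Subtype.ext (hinj x hx k k.2 (by rwa [add_comm])))

theorem isAddFundamentalDomain_cell :
    IsAddFundamentalDomain X.periodGroup X.cell (volume.restrict X.cover) := by
  refine X.isAddFundamentalDomain X.measurableSet_cell.nullMeasurableSet (fun x hx => ?_)
    fun x hx k hk => X.eq_zero_of_mem_cell_of_add_mem_cell hx hk
  obtain ⟨k, hk, hxk⟩ := X.exists_reduce_eq_add x
  exact ⟨k, hk, hxk ▸ X.reduce_mem_cell hx⟩

theorem volume_le_volume_cell {s : Set (𝔼 d)} (hs : NullMeasurableSet s) (hsub : s ⊆ X.cover)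
    (hinj : ∀ x ∈ s, ∀ k ∈ X.periods, x + k ∈ s → k = 0) : volume s ≤ volume X.cell := by
  rw [← Measure.restrict_eq_self volume hsub,
    ← Measure.restrict_eq_self volume X.cell_subset_cover]
  by_contra! hlt
  obtain ⟨x, hx, y, hy, k, hk, rfl⟩ := X.isAddFundamentalDomain_cell.exists_ne_zero_vadd_eq
    (hs.mono_ac Measure.restrict_le_self.absolutelyContinuous) hlt
  simp only [AddSubgroup.vadd_def, vadd_eq_add] at hy
  exact hk (Subtype.ext (hinj x hx k k.2 (by rwa [add_comm])))

end Periods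

variable {X : SampleSpace d}

section Functions

variable {F : Type*}

/-- The function `v` on the cover descends to a function on `Ω`. -/
def IsPeriodic (X : SampleSpace d) (v : 𝔼 d → F) : Prop :=
  ∀ x ∈ X.cover, ∀ k ∈ X.periods, v (x + k) = v x

theorem IsPeriodic.apply_reduce {v : 𝔼 d → F} (hv : X.IsPeriodic v) {x : 𝔼 d} (hx : x ∈ X.cover) :
    v (X.reduce x) = v x := by
  obtain ⟨k, hk, hxk⟩ := X.exists_reduce_eq_add x
  rw [hxk, hv x hx k hk]

theorem integral_congr {f g : 𝔼 d → ℝ} (h : EqOn f g X.cover) : X.integral f = X.integral g :=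
  setIntegral_congr_fun X.measurableSet_cell (h.mono X.cell_subset_cover)

variable [NormedAddCommGroup F]

theorem aestronglyMeasurable_cell {f : 𝔼 d → F} (hf : ContinuousOn f X.cover) :
    AEStronglyMeasurable f (volume.restrict X.cell) :=
  (hf.mono X.cell_subset_cover).aestronglyMeasurable X.measurableSet_cell

theorem integrableOn_cell {f : 𝔼 d → F} (hf : ContinuousOn f X.cover) : IntegrableOn f X.cell :=
  ((hf.mono X.closure_cell_subset_cover).integrableOn_compact
    X.isCompact_closure_cell).mono_set subset_closure

theorem exists_norm_le_on_cell {f : 𝔼 d → F} (hf : ContinuousOn f X.cover) :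
    ∃ C, ∀ x ∈ X.cell, ‖f x‖ ≤ C := by
  obtain ⟨C, hC⟩ := X.isCompact_closure_cell.exists_bound_of_continuousOn
    (hf.mono X.closure_cell_subset_cover)
  exact ⟨C, fun x hx => hC x (subset_closure hx)⟩

theorem IsPeriodic.exists_norm_le_on_cover {f : 𝔼 d → F} (hf : X.IsPeriodic f)
    (hc : ContinuousOn f X.cover) : ∃ C, ∀ x ∈ X.cover, ‖f x‖ ≤ C := by
  obtain ⟨C, hC⟩ := exists_norm_le_on_cell hc
  exact ⟨C, fun x hx => hf.apply_reduce hx ▸ hC _ (X.reduce_mem_cell hx)⟩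

variable [NormedSpace ℝ F]

theorem IsPeriodic.fderivWithin {v : 𝔼 d → F} (hv : X.IsPeriodic v) :
    X.IsPeriodic (fderivWithin ℝ v X.cover) := by
  intro x _ k hk
  cases X with
  | convexBody K _ _ _ => rw [mem_singleton_iff.1 hk, add_zero]
  | torus =>
    simp only [cover, fderivWithin_univ]
    rw [← fderiv_comp_add_right]
    congr 1
    ext x
    exact hv x (mem_univ _) k hk

theorem IsPeriodic.exists_lipschitzOnWith {v : 𝔼 d → F} (hper : X.IsPeriodic v)
    (hv : ContDiffOn ℝ 1 v X.cover) :
    ∃ L : NNReal, (∀ x ∈ X.cover, ‖_root_.fderivWithin ℝ v X.cover x‖ ≤ L) ∧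
      LipschitzOnWith L v X.cover := by
  obtain ⟨C, hC⟩ := hper.fderivWithin.exists_norm_le_on_cover
    (hv.continuousOn_fderivWithin X.uniqueDiffOn_cover le_rfl)
  have norm_le : ∀ x ∈ X.cover, ‖_root_.fderivWithin ℝ v X.cover x‖ ≤ C.toNNReal :=
    fun x hx => (hC x hx).trans (Real.le_coe_toNNReal C)
  exact ⟨C.toNNReal, norm_le, X.convex_cover.lipschitzOnWith_of_nnnorm_hasFDerivWithin_le
    (fun x hx => (hv.differentiableOn one_ne_zero x hx).hasFDerivWithinAt) norm_le⟩

end Functions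

section Divergence

theorem div_eq_trace (v : 𝔼 d → 𝔼 d) (x : 𝔼 d) :
    X.div v x = LinearMap.trace ℝ (𝔼 d) (fderivWithin ℝ v X.cover x) := by
  rw [LinearMap.trace_eq_sum_inner _ (EuclideanSpace.basisFun (Fin d) ℝ)]
  simp [div, EuclideanSpace.inner_single_left]

theorem volume_image_cell_torus_le {v : 𝔼 d → 𝔼 d} (hper : torus.IsPeriodic v) {L : NNReal}
    (hL : LipschitzOnWith L v torus.cover) {t : ℝ} (ht : |t| * L < 1) :
    volume.real ((fun x => x + t • v x) '' torus.cell) ≤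
      volume.real (torus : SampleSpace d).cell := by
  have hinj : Function.Injective fun x => x + t • v x := injOn_univ.1 (injOn_add_smul hL ht)
  have hcont : Continuous fun x => x + t • v x :=
    continuous_id.add ((continuousOn_univ.1 hL.continuousOn).const_smul t)
  have hmeas : MeasurableSet ((fun x => x + t • v x) '' torus.cell) :=
    (hcont.measurableEmbedding hinj).measurableSet_image' torus.measurableSet_cell
  refine ENNReal.toReal_mono torus.isBounded_cell.measure_lt_top.ne
    (torus.volume_le_volume_cell hmeas.nullMeasurableSet (subset_univ _) ?_)
  rintro _ ⟨x, hx, rfl⟩ k hk ⟨y, hy, hxy⟩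
  have hyx : y = x + k := hinj <| by
    simp only at hxy ⊢
    rw [hxy, hper x (mem_univ _) k hk]
    abel
  exact torus.eq_zero_of_mem_cell_of_add_mem_cell hx hk (hyx ▸ hy)

theorem eventually_volume_image_cell_le {v : 𝔼 d → 𝔼 d} (hper : X.IsPeriodic v)
    (hv : IsTangentialOn v X.cover) {L : NNReal} (hL : LipschitzOnWith L v X.cover) :
    ∃ C : ℝ, ∀ᶠ t in 𝓝 (0 : ℝ), volume.real ((fun x => x + t • v x) '' X.cell) ≤
      (1 + C * t ^ 2) ^ d * volume.real X.cell := by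
  cases X with
  | convexBody K hc hK hi =>
    obtain ⟨C, hC⟩ := exists_measureReal_image_add_smul_le (μ := volume) hK hc hi hL hv
    rw [finrank_euclideanSpace_fin] at hC
    exact ⟨C, .of_forall hC⟩
  | torus =>
    have small : ∀ᶠ t : ℝ in 𝓝 0, |t| * L < 1 :=
      (continuous_abs.mul continuous_const).continuousAt.eventually_lt_const (by simp)
    refine ⟨0, small.mono fun t ht => ?_⟩
    simpa using volume_image_cell_torus_le hper hL ht

theorem integral_div_eq_zero {v : 𝔼 d → 𝔼 d} (hv : ContDiffOn ℝ 1 v X.cover)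
    (hper : X.IsPeriodic v) (htan : IsTangentialOn v X.cover) : X.integral (X.div v) = 0 := by
  obtain ⟨L, norm_le, hL⟩ := hper.exists_lipschitzOnWith hv
  obtain ⟨C, hC⟩ := eventually_volume_image_cell_le hper htan hL
  have hG : HasDerivAt (fun t : ℝ => (1 + C * t ^ 2) ^ d) 0 0 := by
    have := (((hasDerivAt_pow 2 (0 : ℝ)).const_mul C).const_add 1).pow d
    exact this.congr_deriv (by simp)
  simp only [integral, div_eq_trace]
  exact setIntegral_trace_fderiv_eq_zero X.measurableSet_cell X.isBounded_cell.measure_lt_top.ne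
    (fun x hx => ((hv.differentiableOn one_ne_zero x
      (X.cell_subset_cover hx)).hasFDerivWithinAt).mono X.cell_subset_cover)
    (fun x hx => norm_le x (X.cell_subset_cover hx)) (hL.mono X.cell_subset_cover)
    (aestronglyMeasurable_cell (hv.continuousOn_fderivWithin X.uniqueDiffOn_cover le_rfl))
    hG (by simp) hC

end Divergence

namespace IsSmooth

variable {f g : 𝔼 d → ℝ}

theorem continuousOn (hf : X.IsSmooth f) : ContinuousOn f X.cover := hf.1.continuousOn

theorem isPeriodic (hf : X.IsSmooth f) : X.IsPeriodic f := hf.2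

theorem differentiableOn (hf : X.IsSmooth f) : DifferentiableOn ℝ f X.cover :=
  hf.1.differentiableOn (by simp)

theorem const (c : ℝ) : X.IsSmooth fun _ => c := ⟨contDiffOn_const, fun _ _ _ _ => rfl⟩

theorem add (hf : X.IsSmooth f) (hg : X.IsSmooth g) : X.IsSmooth fun x => f x + g x :=
  ⟨hf.1.add hg.1, fun x hx k hk => by simp only [hf.2 x hx k hk, hg.2 x hx k hk]⟩

theorem sub (hf : X.IsSmooth f) (hg : X.IsSmooth g) : X.IsSmooth fun x => f x - g x :=
  ⟨hf.1.sub hg.1, fun x hx k hk => by simp only [hf.2 x hx k hk, hg.2 x hx k hk]⟩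

theorem mul (hf : X.IsSmooth f) (hg : X.IsSmooth g) : X.IsSmooth fun x => f x * g x :=
  ⟨hf.1.mul hg.1, fun x hx k hk => by simp only [hf.2 x hx k hk, hg.2 x hx k hk]⟩

theorem neg (hf : X.IsSmooth f) : X.IsSmooth fun x => -f x :=
  ⟨hf.1.neg, fun x hx k hk => by simp only [hf.2 x hx k hk]⟩

theorem const_mul (hf : X.IsSmooth f) (c : ℝ) : X.IsSmooth fun x => c * f x := (const c).mul hf

theorem congr (hf : X.IsSmooth f) (h : EqOn g f X.cover) : X.IsSmooth g :=
  ⟨hf.1.congr h, fun x hx k hk => by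
    rw [h hx, h ((X.add_mem_cover_iff hk).2 hx), hf.2 x hx k hk]⟩

theorem exists_abs_le (hf : X.IsSmooth f) : ∃ C, ∀ x ∈ X.cover, |f x| ≤ C :=
  hf.isPeriodic.exists_norm_le_on_cover hf.continuousOn

theorem contDiffOn_grad (hf : X.IsSmooth f) : ContDiffOn ℝ ∞ (X.grad f) X.cover :=
  (InnerProductSpace.toDual ℝ _).symm.toContinuousLinearEquiv.contDiff.comp_contDiffOn
    (hf.1.fderivWithin X.uniqueDiffOn_cover (by simp))

theorem isPeriodic_grad (hf : X.IsSmooth f) : X.IsPeriodic (X.grad f) := by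
  intro x hx k hk
  rw [grad, gradientWithin, gradientWithin, hf.isPeriodic.fderivWithin x hx k hk]

end IsSmooth

section Gradient

theorem inner_grad (f : 𝔼 d → ℝ) (x w : 𝔼 d) :
    ⟪X.grad f x, w⟫ = fderivWithin ℝ f X.cover x w := by
  simp [grad, gradientWithin, InnerProductSpace.toDual_symm_apply]

theorem grad_sub {f g : 𝔼 d → ℝ} {x : 𝔼 d} (hx : x ∈ X.cover)
    (hf : DifferentiableWithinAt ℝ f X.cover x) (hg : DifferentiableWithinAt ℝ g X.cover x) :
    X.grad (fun y => f y - g y) x = X.grad f x - X.grad g x := by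
  simp only [grad, gradientWithin]
  rw [fderivWithin_fun_sub (X.uniqueDiffOn_cover x hx) hf hg, map_sub]

theorem div_smul {η : 𝔼 d → ℝ} {v : 𝔼 d → 𝔼 d} {x : 𝔼 d} (hx : x ∈ X.cover)
    (hη : DifferentiableWithinAt ℝ η X.cover x) (hv : DifferentiableWithinAt ℝ v X.cover x) :
    X.div (fun y => η y • v y) x = η x * X.div v x + ⟪X.grad η x, v x⟫ := by
  have trace_smulRight : ∑ i, fderivWithin ℝ η X.cover x (EuclideanSpace.single i 1) * v x i =
      fderivWithin ℝ η X.cover x (v x) := by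
    conv_rhs => rw [← (EuclideanSpace.basisFun (Fin d) ℝ).sum_repr (v x)]
    simp [mul_comm]
  rw [inner_grad, ← trace_smulRight, div, div,
    fderivWithin_fun_smul (X.uniqueDiffOn_cover x hx) hη hv, Finset.mul_sum,
    ← Finset.sum_add_distrib]
  rfl

theorem continuousOn_div {v : 𝔼 d → 𝔼 d} (hv : ContDiffOn ℝ 1 v X.cover) :
    ContinuousOn (X.div v) X.cover :=
  continuousOn_finsetSum _ fun i _ =>
    (EuclideanSpace.proj (𝕜 := ℝ) i).continuous.comp_continuousOn
      ((hv.continuousOn_fderivWithin X.uniqueDiffOn_cover le_rfl).clm_apply continuousOn_const)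

theorem integral_mul_div_eq_neg {η : 𝔼 d → ℝ} {v : 𝔼 d → 𝔼 d} (hη : X.IsSmooth η)
    (hv : ContDiffOn ℝ 1 v X.cover) (hper : X.IsPeriodic v) (htan : IsTangentialOn v X.cover) :
    X.integral (fun x => η x * X.div v x) = -X.integral fun x => ⟪X.grad η x, v x⟫ := by
  have integral_div : X.integral (X.div fun y => η y • v y) = 0 := by
    refine integral_div_eq_zero ((hη.1.of_le (by simp)).smul hv) (fun x hx k hk => ?_)
      fun x hx n hn => ?_
    · rw [hη.2 x hx k hk, hper x hx k hk]
    · rw [real_inner_smul_left, htan x hx n hn, mul_zero]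
  have product_rule : EqOn (X.div fun y => η y • v y)
      (fun x => η x * X.div v x + ⟪X.grad η x, v x⟫) X.cover := fun x hx =>
    div_smul hx (hη.differentiableOn x hx) (hv.differentiableOn one_ne_zero x hx)
  have integrable_mul_div : IntegrableOn (fun x => η x * X.div v x) X.cell :=
    integrableOn_cell (hη.continuousOn.mul (continuousOn_div hv))
  have integrable_inner : IntegrableOn (fun x => ⟪X.grad η x, v x⟫) X.cell :=
    integrableOn_cell (hη.contDiffOn_grad.continuousOn.inner hv.continuousOn)
  rw [integral_congr product_rule, integral,
    integral_add integrable_mul_div integrable_inner] at integral_div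
  exact eq_neg_of_add_eq_zero_left integral_div

theorem integral_mul_tangent {q : Density X} {Ψ η : 𝔼 d → ℝ} (hΨ : X.IsTangentPotential q Ψ)
    (hη : X.IsSmooth η) : X.integral (fun x => η x * X.tangent q Ψ x) = X.metric q Ψ η := by
  have by_parts := integral_mul_div_eq_neg (v := fun y => q y • X.grad Ψ y) hη
    ((q.smooth.1.smul hΨ.1.contDiffOn_grad).of_le (by simp))
    (fun x hx k hk => by simp only [q.smooth.2 x hx k hk, hΨ.1.isPeriodic_grad x hx k hk])
    (fun x hx n hn => by rw [real_inner_smul_left, hΨ.2 x hx n hn])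
  simp only [tangent, mul_neg, metric, integral, MeasureTheory.integral_neg] at by_parts ⊢
  rw [by_parts, neg_neg]
  simp only [real_inner_smul_right, real_inner_comm, mul_comm]

theorem IsTangentPotential.isWassersteinGradient {q : Density X} {f : 𝔼 d → ℝ}
    (hf : X.IsTangentPotential q f) : X.IsWassersteinGradient q f (X.tangent q f) := by
  refine ⟨f, hf, fun _ _ => rfl, fun Φ hΦ => ?_⟩
  rw [integral_mul_tangent hΦ hf.1]
  simp only [metric, real_inner_comm]

end Gradient

namespace Density

variable (q : Density X)

theorem ae_nonneg : ∀ᵐ x ∂(volume.restrict X.cell), 0 ≤ q x := by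
  filter_upwards [ae_restrict_mem X.measurableSet_cell] with x hx
  exact q.nonneg x (X.cell_subset_cover hx)

theorem aemeasurable : AEMeasurable q (volume.restrict X.cell) :=
  (aestronglyMeasurable_cell q.smooth.continuousOn).aemeasurable

theorem integrable : Integrable q (volume.restrict X.cell) :=
  integrableOn_cell q.smooth.continuousOn

theorem integral_toMeasure (h : 𝔼 d → ℝ) :
    ∫ x, h x ∂q.toMeasure = X.integral fun x => h x * q x := by
  rw [toMeasure, integral_withDensity_eq_integral_toReal_smul₀ q.aemeasurable.ennreal_ofReal
    (.of_forall fun _ => ENNReal.ofReal_lt_top)]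
  refine integral_congr_ae ?_
  filter_upwards [q.ae_nonneg] with x hx
  rw [ENNReal.toReal_ofReal hx, smul_eq_mul, mul_comm]

theorem toMeasure_absolutelyContinuous : q.toMeasure ≪ volume.restrict X.cell :=
  withDensity_absolutelyContinuous _ _

theorem ae_mem_cell : ∀ᵐ x ∂q.toMeasure, x ∈ X.cell :=
  q.toMeasure_absolutelyContinuous.ae_le (ae_restrict_mem X.measurableSet_cell)

instance : IsProbabilityMeasure q.toMeasure where
  measure_univ := by
    rw [toMeasure, withDensity_apply _ .univ, Measure.restrict_univ,
      ← ofReal_integral_eq_lintegral_ofReal q.integrable q.ae_nonneg]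
    exact ENNReal.ofReal_eq_one.2 q.integral_eq_one

theorem hasBoundedDensity_volume : HasBoundedDensity q.toMeasure volume := by
  obtain ⟨C, hC⟩ := q.smooth.exists_abs_le
  refine .trans (hasBoundedDensity_withDensity_ofReal_of_le (C := C) ?_)
    (HasBoundedDensity.mono ⟨1, (one_smul _ _).ge⟩ Measure.restrict_le_self)
  filter_upwards [ae_restrict_mem X.measurableSet_cell] with x hx
  exact (le_abs_self _).trans (hC x (X.cell_subset_cover hx))

theorem hasConvexCores (hq : ∀ x ∈ interior X.cover, 0 < q x) :
    HasConvexCores q.toMeasure volume := by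
  intro ε hε
  obtain ⟨K, hKint, hK, hKε⟩ := isOpen_interior.measurableSet.exists_isCompact_sdiff_lt
    (μ := q.toMeasure) (measure_ne_top _ (interior X.cell)) hε
  obtain ⟨c, hc, hconv, hKc, hcint⟩ :=
    exists_isCompact_convex_between hK X.convex_cell.interior isOpen_interior hKint
  have hcell : c ⊆ X.cell := hcint.trans interior_subset
  refine ⟨c, hc.measurableSet, hconv, ?_, ?_⟩
  · refine (measure_mono_ae ?_).trans hKε.le
    filter_upwards [q.toMeasure_absolutelyContinuous.ae_le X.ae_mem_interior_cell] with x hx hxc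
    exact ⟨hx, fun hxK => hxc (hKc hxK)⟩
  · obtain ⟨a, ha, haq⟩ := hc.exists_forall_le' (a := 0)
      (q.smooth.continuousOn.mono (hcell.trans X.cell_subset_cover))
      fun x hx => hq x (interior_mono X.cell_subset_cover (hcint hx))
    have := hasBoundedDensity_restrict_withDensity_ofReal (μ := volume.restrict X.cell) ha
      hc.measurableSet haq
    rwa [Measure.restrict_restrict hc.measurableSet, inter_eq_left.2 hcell] at this

variable {q} {σ : 𝔼 d → ℝ} {C ε : ℝ}

theorem exists_isNetTransport_withDensity (hq : ∀ x ∈ interior X.cover, 0 < q x)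
    (hσ : X.IsSmooth σ) (hσ₀ : X.integral σ = 0) (hC : ∀ x ∈ X.cover, |σ x| ≤ C * q x)
    (hε : 0 < ε) : ∃ m, HasBoundedDensity (m.map Prod.fst) q.toMeasure ∧
      IsNetTransport m ((volume.restrict X.cell).withDensity fun x => ENNReal.ofReal (-σ x))
        ((volume.restrict X.cell).withDensity fun x => ENNReal.ofReal (σ x)) ∧
      quadCost m ≤ ENNReal.ofReal ε := by
  set lebesgue := volume.restrict X.cell
  have integrable_σ : Integrable σ lebesgue := integrableOn_cell hσ.continuousOn
  set μ := lebesgue.withDensity fun x => ENNReal.ofReal (-σ x)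
  set ν := lebesgue.withDensity fun x => ENNReal.ofReal (σ x)
  have ae_abs_le : ∀ᵐ x ∂lebesgue, |σ x| ≤ C * q x := by
    filter_upwards [ae_restrict_mem X.measurableSet_cell] with x hx
    exact hC x (X.cell_subset_cover hx)
  have hμ : HasBoundedDensity μ q.toMeasure := hasBoundedDensity_withDensity_ofReal
    (ae_abs_le.mono fun x hx => (neg_le_abs _).trans hx) q.ae_nonneg
  have hν : HasBoundedDensity ν q.toMeasure := hasBoundedDensity_withDensity_ofReal
    (ae_abs_le.mono fun x hx => (le_abs_self _).trans hx) q.ae_nonneg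
  have : IsFiniteMeasure μ := isFiniteMeasure_withDensity_ofReal integrable_σ.neg.2
  have : IsFiniteMeasure ν := isFiniteMeasure_withDensity_ofReal integrable_σ.2
  exact exists_isNetTransport_quadCost_le hμ hν q.hasBoundedDensity_volume (q.hasConvexCores hq)
    (withDensity_ofReal_univ_eq_of_integral_eq_zero integrable_σ hσ₀)
    (quadCost_ne_top X.isBounded_cell
      (Measure.quasiMeasurePreserving_fst.ae (hμ.absolutelyContinuous.ae_le q.ae_mem_cell))
      (Measure.quasiMeasurePreserving_snd.ae (hν.absolutelyContinuous.ae_le q.ae_mem_cell)))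
    (ENNReal.ofReal_pos.2 hε).ne'

theorem eventually_exists_isCoupling_add_mul_of_nonneg (hq : ∀ x ∈ interior X.cover, 0 < q x)
    (hσ : X.IsSmooth σ) (hσ₀ : X.integral σ = 0) (hC : ∀ x ∈ X.cover, |σ x| ≤ C * q x)
    (hε : 0 < ε) : ∀ᶠ t : ℝ≥0 in 𝓝 0, ∀ r : Density X, (∀ x ∈ X.cover, r x = q x + t * σ x) →
      ∃ γ, IsCoupling γ q.toMeasure r.toMeasure ∧ quadCost γ ≤ t * ENNReal.ofReal ε := by
  set lebesgue := volume.restrict X.cell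
  have integrable_σ : Integrable σ lebesgue := integrableOn_cell hσ.continuousOn
  have : IsFiniteMeasure (lebesgue.withDensity fun x => ENNReal.ofReal (-σ x)) :=
    isFiniteMeasure_withDensity_ofReal integrable_σ.neg.2
  obtain ⟨m, ⟨B, hB⟩, hm, cost_le⟩ := exists_isNetTransport_withDensity hq hσ hσ₀ hC hε
  have eventually_le : ∀ᶠ t : ℝ≥0 in 𝓝 0, t * B ≤ 1 :=
    (continuous_mul_const B).continuousAt.eventually_le_const (by simp)
  filter_upwards [eventually_le] with t htB r hr
  have toMeasure_eq : r.toMeasure =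
      lebesgue.withDensity fun x => ENNReal.ofReal (q x + t * σ x) := by
    refine withDensity_congr_ae ?_
    filter_upwards [ae_restrict_mem X.measurableSet_cell] with x hx
    rw [hr x (X.cell_subset_cover hx)]
  have add_nonneg : ∀ᵐ x ∂lebesgue, 0 ≤ q x + t * σ x := by
    filter_upwards [ae_restrict_mem X.measurableSet_cell, r.ae_nonneg] with x hx hrx
    rwa [← hr x (X.cell_subset_cover hx)]
  obtain ⟨γ, hγ, cost_eq⟩ := hm.exists_isCoupling hB htB (Q' := r.toMeasure) <| by
    rw [toMeasure_eq, withDensity_ofReal_add_mul q.aemeasurable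
      integrable_σ.aestronglyMeasurable.aemeasurable q.ae_nonneg add_nonneg, toMeasure]
  exact ⟨γ, hγ, cost_eq.trans_le (by gcongr)⟩

theorem eventually_exists_isCoupling_add_mul (hq : ∀ x ∈ interior X.cover, 0 < q x)
    (hσ : X.IsSmooth σ) (hσ₀ : X.integral σ = 0) (hC : ∀ x ∈ X.cover, |σ x| ≤ C * q x)
    (hε : 0 < ε) : ∀ᶠ t in 𝓝 (0 : ℝ), ∀ r : Density X, (∀ x ∈ X.cover, r x = q x + t * σ x) →
      ∃ γ, IsCoupling γ q.toMeasure r.toMeasure ∧ quadCost γ ≤ ENNReal.ofReal (|t| * ε) := by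
  have integral_neg : X.integral (fun x => -σ x) = 0 := by
    rw [integral, MeasureTheory.integral_neg, ← integral, hσ₀, neg_zero]
  have tendsto_nnnorm : Tendsto (fun t : ℝ => ‖t‖₊) (𝓝 0) (𝓝 0) := by
    simpa using (continuous_nnnorm (E := ℝ)).tendsto 0
  filter_upwards [tendsto_nnnorm.eventually
      (eventually_exists_isCoupling_add_mul_of_nonneg hq hσ hσ₀ hC hε),
    tendsto_nnnorm.eventually (eventually_exists_isCoupling_add_mul_of_nonneg hq hσ.neg integral_neg
      (by simpa only [abs_neg] using hC) hε)] with t pos neg r hr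
  rw [ENNReal.ofReal_mul (abs_nonneg t), ← Real.norm_eq_abs, ofReal_norm, enorm_eq_nnnorm]
  rcases le_total 0 t with ht | ht
  · exact pos r fun x hx => by rw [coe_nnnorm, Real.norm_of_nonneg ht, hr x hx]
  · exact neg r fun x hx => by rw [coe_nnnorm, Real.norm_of_nonpos ht, neg_mul_neg, hr x hx]

end Density

section TransportMap

theorem IsPeriodic.apply_add {F : Type*} {v : 𝔼 d → F} (hv : X.IsPeriodic v) (x : 𝔼 d) {k : 𝔼 d}
    (hk : k ∈ X.periods) : v (x + k) = v x := by
  cases X with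
  | convexBody K _ _ _ => rw [mem_singleton_iff.1 hk, add_zero]
  | torus => exact hv x (mem_univ x) k hk

theorem IsPeriodic.lintegral_eq {s : Set (𝔼 d)} {H : 𝔼 d → ℝ≥0∞} (hH : X.IsPeriodic H)
    (hs : NullMeasurableSet s (volume.restrict X.cover)) (hsub : s ⊆ X.cover)
    (hcover : ∀ x ∈ X.cover, ∃ k ∈ X.periods, x + k ∈ s)
    (hinj : ∀ x ∈ s, ∀ k ∈ X.periods, x + k ∈ s → k = 0) :
    ∫⁻ x in s, H x = ∫⁻ x in X.cell, H x := by
  have := (X.isAddFundamentalDomain hs hcover hinj).setLIntegral_eq X.isAddFundamentalDomain_cell H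
    fun k x => by rw [AddSubgroup.vadd_def, vadd_eq_add, add_comm, hH.apply_add x k.2]
  simpa only [Measure.restrict_restrict₀' X.isClosed_cover.measurableSet.nullMeasurableSet,
    inter_eq_left.2 hsub, inter_eq_left.2 X.cell_subset_cover] using this

namespace IsTransportPotential

variable {p q : Density X} {Φ : 𝔼 d → ℝ} (hΦ : X.IsTransportPotential q p Φ)

include hΦ

theorem differentiableOn : DifferentiableOn ℝ Φ X.cover := by
  intro x hx
  have := (hΦ.1.differentiableOn x hx).add
    (hasFDerivWithinAt_norm_sq_div_two x X.cover).differentiableWithinAt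
  exact this.congr (fun y _ => by simp) (by simp)

theorem mapsTo_grad : MapsTo (X.grad Φ) X.cover X.cover := hΦ.2.2.1.mapsTo

theorem injOn_grad : InjOn (X.grad Φ) X.cover := hΦ.2.2.1.injOn

theorem grad_sub_half_norm_sq {x : 𝔼 d} (hx : x ∈ X.cover) :
    X.grad (fun y => Φ y - ‖y‖ ^ 2 / 2) x = X.grad Φ x - x := by
  have hnorm := hasFDerivWithinAt_norm_sq_div_two x X.cover
  rw [grad_sub hx (hΦ.differentiableOn x hx) hnorm.differentiableWithinAt]
  congr 1
  refine ext_inner_right ℝ fun w => ?_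
  rw [inner_grad, hnorm.fderivWithin (X.uniqueDiffOn_cover x hx), innerSL_apply_apply]

theorem grad_eq_add {x : 𝔼 d} (hx : x ∈ X.cover) :
    X.grad Φ x = X.grad (fun y => Φ y - ‖y‖ ^ 2 / 2) x + x := by
  rw [hΦ.grad_sub_half_norm_sq hx, sub_add_cancel]

theorem contDiffOn_grad : ContDiffOn ℝ ∞ (X.grad Φ) X.cover :=
  (hΦ.1.contDiffOn_grad.add contDiffOn_id).congr fun _ hx => hΦ.grad_eq_add hx

theorem hasFDerivWithinAt_grad {x : 𝔼 d} (hx : x ∈ X.cell) :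
    HasFDerivWithinAt (X.grad Φ) (fderivWithin ℝ (X.grad Φ) X.cover x) X.cell x :=
  ((hΦ.contDiffOn_grad.differentiableOn (by simp) x
    (X.cell_subset_cover hx)).hasFDerivWithinAt).mono X.cell_subset_cover

theorem exists_lipschitzOnWith_grad : ∃ L, LipschitzOnWith L (X.grad Φ) X.cover := by
  obtain ⟨L, -, hL⟩ := hΦ.1.isPeriodic_grad.exists_lipschitzOnWith
    (hΦ.1.contDiffOn_grad.of_le (by simp))
  refine ⟨L + 1, fun x hx y hy => ?_⟩
  rw [hΦ.grad_eq_add hx, hΦ.grad_eq_add hy]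
  exact hL.add LipschitzWith.id.lipschitzOnWith hx hy

theorem grad_add_period {x k : 𝔼 d} (hx : x ∈ X.cover) (hk : k ∈ X.periods) :
    X.grad Φ (x + k) = X.grad Φ x + k := by
  rw [hΦ.grad_eq_add ((X.add_mem_cover_iff hk).2 hx), hΦ.1.isPeriodic_grad x hx k hk,
    hΦ.grad_eq_add hx, add_assoc]

theorem lintegral_image_cell {H : 𝔼 d → ℝ≥0∞} (hH : X.IsPeriodic H) :
    ∫⁻ x in X.grad Φ '' X.cell, H x = ∫⁻ x in X.cell, H x := by
  have image_subset : X.grad Φ '' X.cell ⊆ X.cover :=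
    (hΦ.mapsTo_grad.mono_left X.cell_subset_cover).image_subset
  have measurableSet_image : MeasurableSet (X.grad Φ '' X.cell) :=
    measurable_image_of_fderivWithin X.measurableSet_cell (fun _ => hΦ.hasFDerivWithinAt_grad)
      (hΦ.injOn_grad.mono X.cell_subset_cover)
  refine hH.lintegral_eq measurableSet_image.nullMeasurableSet image_subset (fun x hx => ?_) ?_
  · obtain ⟨y, hy, rfl⟩ := hΦ.2.2.1.surjOn hx
    obtain ⟨k, hk, hyk⟩ := X.exists_reduce_eq_add y
    exact ⟨k, hk, X.reduce y, X.reduce_mem_cell hy, hyk ▸ hΦ.grad_add_period hy hk⟩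
  · rintro _ ⟨x, hx, rfl⟩ k hk ⟨y, hy, hxy⟩
    have hx' := X.cell_subset_cover hx
    rw [← hΦ.grad_add_period hx' hk] at hxy
    obtain rfl : y = x + k :=
      hΦ.injOn_grad (X.cell_subset_cover hy) ((X.add_mem_cover_iff hk).2 hx') hxy
    exact X.eq_zero_of_mem_cell_of_add_mem_cell hx hk hy

theorem ofReal_abs_det_mul {x : 𝔼 d} (hx : x ∈ X.cover) :
    ENNReal.ofReal |(fderivWithin ℝ (X.grad Φ) X.cover x).det| *
      ENNReal.ofReal (p (X.grad Φ x)) = ENNReal.ofReal (q x) := by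
  rw [← ENNReal.ofReal_mul (abs_nonneg _), ← abs_of_nonneg (p.nonneg _ (hΦ.mapsTo_grad hx)),
    ← abs_mul, mul_comm, hΦ.2.2.2 x hx, abs_of_nonneg (q.nonneg x hx)]

theorem lintegral_cell_mul_density {H : 𝔼 d → ℝ≥0∞} (hH : X.IsPeriodic H) :
    ∫⁻ x in X.cell, ENNReal.ofReal (q x) * H (X.grad Φ x) =
      ∫⁻ x in X.cell, ENNReal.ofReal (p x) * H x := calc
  _ = ∫⁻ x in X.cell, ENNReal.ofReal |(fderivWithin ℝ (X.grad Φ) X.cover x).det| *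
        (ENNReal.ofReal (p (X.grad Φ x)) * H (X.grad Φ x)) :=
    setLIntegral_congr_fun X.measurableSet_cell fun x hx => by
      rw [← mul_assoc, hΦ.ofReal_abs_det_mul (X.cell_subset_cover hx)]
  _ = ∫⁻ x in X.grad Φ '' X.cell, ENNReal.ofReal (p x) * H x :=
    (lintegral_image_eq_lintegral_abs_det_fderiv_mul volume X.measurableSet_cell
      (fun _ => hΦ.hasFDerivWithinAt_grad) (hΦ.injOn_grad.mono X.cell_subset_cover)
      fun x => ENNReal.ofReal (p x) * H x).symm
  _ = _ := hΦ.lintegral_image_cell fun x hx k hk => by rw [p.smooth.2 x hx k hk, hH x hx k hk]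

end IsTransportPotential

theorem reduce_of_mem_cell {x : 𝔼 d} (hx : x ∈ X.cell) : X.reduce x = x := by
  obtain ⟨k, hk, hxk⟩ := X.exists_reduce_eq_add x
  have k_eq_zero : k = 0 := X.eq_zero_of_mem_cell_of_add_mem_cell hx hk
    (hxk ▸ X.reduce_mem_cell (X.cell_subset_cover hx))
  rw [hxk, k_eq_zero, add_zero]

theorem isPeriodic_reduce : X.IsPeriodic X.reduce := by
  intro x _ k hk
  cases X with
  | convexBody K _ _ _ => rw [mem_singleton_iff.1 hk, add_zero]
  | torus =>
    ext i
    obtain ⟨m, hm⟩ := hk i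
    simp [reduce, hm]

/-- The transport map `∇Φ`, as a map of the cell into itself: on the torus, the value of `∇Φ` is
replaced by its representative in the cell. -/
noncomputable def transportMap (X : SampleSpace d) (Φ : 𝔼 d → ℝ) (x : 𝔼 d) : 𝔼 d :=
  X.reduce (X.grad Φ x)

namespace IsTransportPotential

variable {p q : Density X} {Φ : 𝔼 d → ℝ} (hΦ : X.IsTransportPotential q p Φ)

include hΦ

theorem aemeasurable_transportMap : AEMeasurable (X.transportMap Φ) q.toMeasure :=
  X.measurable_reduce.comp_aemeasurable <| (aestronglyMeasurable_cell
    hΦ.contDiffOn_grad.continuousOn).aemeasurable.mono_ac q.toMeasure_absolutelyContinuous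

theorem map_transportMap : q.toMeasure.map (X.transportMap Φ) = p.toMeasure := by
  refine Measure.ext fun A hA => ?_
  have lintegral_toMeasure : ∀ (r : Density X) (H : 𝔼 d → ℝ≥0∞), ∫⁻ x, H x ∂r.toMeasure =
      ∫⁻ x in X.cell, ENNReal.ofReal (r x) * H x := fun r H =>
    lintegral_withDensity_eq_lintegral_mul_non_measurable₀ _ r.aemeasurable.ennreal_ofReal
      (.of_forall fun _ => ENNReal.ofReal_lt_top) H
  calc q.toMeasure.map (X.transportMap Φ) A
    _ = ∫⁻ y, A.indicator 1 y ∂q.toMeasure.map (X.transportMap Φ) :=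
      (lintegral_indicator_one hA).symm
    _ = ∫⁻ x, A.indicator 1 (X.transportMap Φ x) ∂q.toMeasure :=
      lintegral_map' (measurable_one.indicator hA).aemeasurable hΦ.aemeasurable_transportMap
    _ = ∫⁻ x in X.cell, ENNReal.ofReal (q x) * A.indicator 1 (X.reduce (X.grad Φ x)) :=
      lintegral_toMeasure q _
    _ = ∫⁻ x in X.cell, ENNReal.ofReal (p x) * A.indicator 1 (X.reduce x) :=
      hΦ.lintegral_cell_mul_density (H := fun x => A.indicator 1 (X.reduce x)) fun x hx k hk => by
        simp only [isPeriodic_reduce x hx k hk]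
    _ = ∫⁻ x in X.cell, ENNReal.ofReal (p x) * A.indicator 1 x :=
      setLIntegral_congr_fun X.measurableSet_cell fun x hx => by rw [reduce_of_mem_cell hx]
    _ = p.toMeasure A := by rw [← lintegral_toMeasure, lintegral_indicator_one hA]

end IsTransportPotential

end TransportMap

section SqDist

theorem sqDist_nonneg (x y : 𝔼 d) : 0 ≤ X.sqDist x y := Real.iInf_nonneg fun _ => sq_nonneg _

theorem sqDist_le {k : 𝔼 d} (hk : k ∈ X.periods) (x y : 𝔼 d) : X.sqDist x y ≤ ‖x - y - k‖ ^ 2 :=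
  ciInf_le ⟨0, forall_mem_range.2 fun _ => sq_nonneg _⟩ (⟨k, hk⟩ : X.periods)

theorem sqDist_reduce_le (x y : 𝔼 d) : X.sqDist (X.reduce x) y ≤ ‖x - y‖ ^ 2 := by
  obtain ⟨k, hk, hxk⟩ := X.exists_reduce_eq_add x
  convert sqDist_le hk (X.reduce x) y using 3
  rw [hxk]
  abel

theorem measurable_sqDist : Measurable fun z : 𝔼 d × 𝔼 d => X.sqDist z.1 z.2 :=
  Measurable.iInf fun _ => by fun_prop

end SqDist

section Couplings

variable {p r : Density X} {π : Measure (𝔼 d × 𝔼 d)}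

theorem Density.integrable_of_continuousOn (p : Density X) {g : 𝔼 d → ℝ}
    (hg : ContinuousOn g X.cover) : Integrable g p.toMeasure := by
  obtain ⟨C, hC⟩ := exists_norm_le_on_cell hg
  exact .of_bound ((aestronglyMeasurable_cell hg).mono_ac p.toMeasure_absolutelyContinuous) C
    (p.ae_mem_cell.mono hC)

theorem ae_fst_mem_cell (hπ : IsCoupling π p.toMeasure r.toMeasure) : ∀ᵐ z ∂π, z.1 ∈ X.cell :=
  ae_of_ae_map measurable_fst.aemeasurable (hπ.map_fst ▸ p.ae_mem_cell)

theorem ae_snd_mem_cell (hπ : IsCoupling π p.toMeasure r.toMeasure) : ∀ᵐ z ∂π, z.2 ∈ X.cell :=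
  ae_of_ae_map measurable_snd.aemeasurable (hπ.map_snd ▸ r.ae_mem_cell)

theorem quadCost_ne_top_of_isCoupling (hπ : IsCoupling π p.toMeasure r.toMeasure) :
    quadCost π ≠ ⊤ := by
  have : IsProbabilityMeasure (π.map Prod.fst) := hπ.map_fst ▸ inferInstance
  have := Measure.isProbabilityMeasure_of_map (μ := π) Prod.fst
  exact quadCost_ne_top X.isBounded_cell (ae_fst_mem_cell hπ) (ae_snd_mem_cell hπ)

theorem integrable_sqDist (hπ : IsCoupling π p.toMeasure r.toMeasure) :
    Integrable (fun z => X.sqDist z.1 z.2) π :=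
  (integrable_norm_sub_sq (quadCost_ne_top_of_isCoupling hπ)).mono'
    measurable_sqDist.aestronglyMeasurable <| .of_forall fun z => by
      rw [Real.norm_of_nonneg (sqDist_nonneg _ _)]
      simpa using sqDist_le X.zero_mem_periods z.1 z.2

theorem wassersteinDist_sq (p r : Density X) : X.wassersteinDist p r ^ 2 =
    sInf {c : ℝ | ∃ π : Measure (𝔼 d × 𝔼 d), π.map Prod.fst = p.toMeasure ∧
      π.map Prod.snd = r.toMeasure ∧ c = ∫ z, X.sqDist z.1 z.2 ∂π} := by
  refine Real.sq_sqrt (Real.sInf_nonneg ?_)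
  rintro _ ⟨π, -, -, rfl⟩
  exact integral_nonneg fun z => sqDist_nonneg _ _

theorem wassersteinDist_sq_le (hπ : IsCoupling π p.toMeasure r.toMeasure) :
    X.wassersteinDist p r ^ 2 ≤ ∫ z, X.sqDist z.1 z.2 ∂π := by
  rw [wassersteinDist_sq]
  refine csInf_le ⟨0, ?_⟩ ⟨π, hπ.map_fst, hπ.map_snd, rfl⟩
  rintro _ ⟨π, -, -, rfl⟩
  exact integral_nonneg fun z => sqDist_nonneg _ _

theorem le_wassersteinDist_sq {a : ℝ} (ha : ∀ π : Measure (𝔼 d × 𝔼 d),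
    IsCoupling π p.toMeasure r.toMeasure → a ≤ ∫ z, X.sqDist z.1 z.2 ∂π) :
    a ≤ X.wassersteinDist p r ^ 2 := by
  have hprod := isCoupling_inv_smul_prod (μ := p.toMeasure) (ν := r.toMeasure)
    (by simp only [measure_univ]) (by simp)
  rw [wassersteinDist_sq]
  refine le_csInf ⟨_, _, hprod.map_fst, hprod.map_snd, rfl⟩ ?_
  rintro _ ⟨π, hfst, hsnd, rfl⟩
  exact ha π ⟨hfst, hsnd⟩

end Couplings

section CTransform

/-- The `c`-transform of the Kantorovich potential `η` on `Ω`, for the quadratic cost. The infimum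
over the whole cover makes it periodic when `η` is. -/
noncomputable def cTransform (X : SampleSpace d) (η : 𝔼 d → ℝ) (y : 𝔼 d) : ℝ :=
  ⨅ x : X.cover, (‖(x : 𝔼 d) - y‖ ^ 2 - η x)

instance : Nonempty X.cover := X.nonempty_cover.to_subtype

variable {η : 𝔼 d → ℝ}

theorem le_cTransform {a : ℝ} {y : 𝔼 d} (ha : ∀ x ∈ X.cover, a ≤ ‖x - y‖ ^ 2 - η x) :
    a ≤ X.cTransform η y :=
  le_ciInf fun x => ha x x.2

variable (hη : BddAbove (η '' X.cover))

include hη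

theorem bddBelow_range_norm_sq_sub (y : 𝔼 d) :
    BddBelow (range fun x : X.cover => ‖(x : 𝔼 d) - y‖ ^ 2 - η x) := by
  obtain ⟨C, hC⟩ := hη
  refine ⟨-C, forall_mem_range.2 fun x => ?_⟩
  linarith [hC (mem_image_of_mem η x.2), sq_nonneg ‖(x : 𝔼 d) - y‖]

theorem cTransform_le {x : 𝔼 d} (hx : x ∈ X.cover) (y : 𝔼 d) :
    X.cTransform η y ≤ ‖x - y‖ ^ 2 - η x :=
  ciInf_le (bddBelow_range_norm_sq_sub hη y) (⟨x, hx⟩ : X.cover)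

theorem measurable_cTransform : Measurable (X.cTransform η) :=
  (upperSemicontinuous_ciInf (bddBelow_range_norm_sq_sub hη) fun _ =>
    Continuous.upperSemicontinuous (by fun_prop)).measurable

theorem integrable_cTransform (p : Density X) : Integrable (X.cTransform η) p.toMeasure := by
  obtain ⟨C, hC⟩ := id hη
  obtain ⟨x₀, hx₀⟩ := X.nonempty_cover
  have upper : Integrable (fun y => ‖x₀ - y‖ ^ 2 - η x₀) p.toMeasure :=
    p.integrable_of_continuousOn (by fun_prop)
  refine integrable_of_le_of_le (measurable_cTransform hη).aestronglyMeasurable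
    (.of_forall fun y => le_cTransform fun x hx => ?_)
    (.of_forall fun y => cTransform_le hη hx₀ y) (integrable_const (-C)) upper
  linarith [hC (mem_image_of_mem η hx), sq_nonneg ‖x - y‖]

variable (hper : X.IsPeriodic η)

include hper

theorem cTransform_add_le_sqDist {x : 𝔼 d} (hx : x ∈ X.cover) (y : 𝔼 d) :
    X.cTransform η y + η x ≤ X.sqDist y x := by
  refine le_ciInf fun k => ?_
  have := cTransform_le hη ((X.add_mem_cover_iff k.2).2 hx) y
  rw [hper x hx k k.2, norm_sub_rev, ← sub_sub] at this
  linarith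

theorem isPeriodic_cTransform : X.IsPeriodic (X.cTransform η) := by
  have add_period_le : ∀ y, ∀ k ∈ X.periods, X.cTransform η (y + k) ≤ X.cTransform η y := by
    refine fun y k hk => le_cTransform fun x hx => ?_
    have := cTransform_le hη ((X.add_mem_cover_iff hk).2 hx) (y + k)
    rwa [hper x hx k hk, add_sub_add_right_eq_sub] at this
  refine fun y _ k hk => (add_period_le y k hk).antisymm ?_
  simpa using add_period_le (y + k) (-k) (X.neg_mem_periods hk)

theorem integral_cTransform_add_integral_le (p r : Density X) (hr : Integrable η r.toMeasure) :
    ∫ y, X.cTransform η y ∂p.toMeasure + ∫ x, η x ∂r.toMeasure ≤ X.wassersteinDist p r ^ 2 := by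
  refine le_wassersteinDist_sq fun π hπ => ?_
  have hp := integrable_cTransform hη p
  rw [← hπ.integral_fst_add_snd hp hr]
  refine integral_mono_ae (hπ.integrable_fst_add_snd hp hr) (integrable_sqDist hπ) ?_
  filter_upwards [ae_snd_mem_cell hπ] with z hz
  exact cTransform_add_le_sqDist hη hper (X.cell_subset_cover hz) z.1

end CTransform

/-- The Kantorovich potential of the transport map `∇Φ`, for the cost `‖x - y‖²`. -/
noncomputable def kantorovichPotential (Φ : 𝔼 d → ℝ) (x : 𝔼 d) : ℝ := ‖x‖ ^ 2 - 2 * Φ x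

namespace IsTransportPotential

variable {p q : Density X} {Φ : 𝔼 d → ℝ} (hΦ : X.IsTransportPotential q p Φ)

include hΦ

theorem isSmooth_kantorovichPotential : X.IsSmooth (kantorovichPotential Φ) :=
  (hΦ.1.const_mul (-2)).congr fun x _ => by
    rw [kantorovichPotential]
    ring

theorem grad_kantorovichPotential {x : 𝔼 d} (hx : x ∈ X.cover) :
    X.grad (kantorovichPotential Φ) x = (2 : ℝ) • (x - X.grad Φ x) := by
  have eq_smul : kantorovichPotential Φ = fun x => (-2 : ℝ) • (Φ x - ‖x‖ ^ 2 / 2) := by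
    ext x
    rw [kantorovichPotential, smul_eq_mul]
    ring
  have grad_sub_half := hΦ.grad_sub_half_norm_sq hx
  simp only [grad, gradientWithin] at grad_sub_half ⊢
  rw [eq_smul, fderivWithin_fun_const_smul (X.uniqueDiffOn_cover x hx)
    (hΦ.1.differentiableOn x hx), map_smul, grad_sub_half]
  module

theorem bddAbove_kantorovichPotential : BddAbove (kantorovichPotential Φ '' X.cover) := by
  obtain ⟨C, hC⟩ := hΦ.isSmooth_kantorovichPotential.exists_abs_le
  exact ⟨C, forall_mem_image.2 fun x hx => (le_abs_self _).trans (hC x hx)⟩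

theorem inner_grad_le_sub {x y : 𝔼 d} (hx : x ∈ X.cover) (hy : y ∈ X.cover) :
    ⟪X.grad Φ x, y - x⟫ ≤ Φ y - Φ x := by
  rw [inner_grad]
  exact hasFDerivWithinAt_apply_sub_le_sub_of_convexOn hΦ.2.1.convexOn
    (hΦ.differentiableOn x hx).hasFDerivWithinAt hx hy

theorem exists_sub_sub_inner_grad_le : ∃ L : NNReal, ∀ x ∈ X.cover, ∀ y ∈ X.cover,
    Φ y - Φ x - ⟪X.grad Φ x, y - x⟫ ≤ L * ‖x - y‖ ^ 2 := by
  obtain ⟨L, hL⟩ := hΦ.exists_lipschitzOnWith_grad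
  have lipschitzOnWith : LipschitzOnWith L (fderivWithin ℝ Φ X.cover) X.cover := by
    intro x hx y hy
    have := hL hx hy
    rwa [grad, gradientWithin, gradientWithin, LinearIsometryEquiv.edist_map] at this
  refine ⟨L, fun x hx y hy => ?_⟩
  rw [inner_grad, norm_sub_rev]
  exact (Real.le_norm_self _).trans <| norm_sub_sub_fderiv_apply_le_of_lipschitzOnWith
    X.convex_cover (fun z hz => (hΦ.differentiableOn z hz).hasFDerivWithinAt) lipschitzOnWith hx hy

theorem cTransform_grad {x : 𝔼 d} (hx : x ∈ X.cover) :
    X.cTransform (kantorovichPotential Φ) (X.grad Φ x) =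
      ‖x - X.grad Φ x‖ ^ 2 - kantorovichPotential Φ x := by
  refine (cTransform_le hΦ.bddAbove_kantorovichPotential hx _).antisymm
    (le_cTransform fun y hy => ?_)
  rw [norm_sub_sq_eq_potential_add x y (X.grad Φ x) (Φ x) (Φ y)]
  simp only [kantorovichPotential]
  linarith [hΦ.inner_grad_le_sub hx hy]

theorem cTransform_transportMap {x : 𝔼 d} (hx : x ∈ X.cover) :
    X.cTransform (kantorovichPotential Φ) (X.transportMap Φ x) =
      ‖x - X.grad Φ x‖ ^ 2 - kantorovichPotential Φ x := by
  rw [transportMap, (isPeriodic_cTransform hΦ.bddAbove_kantorovichPotential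
    hΦ.isSmooth_kantorovichPotential.isPeriodic).apply_reduce (hΦ.mapsTo_grad hx),
    hΦ.cTransform_grad hx]

theorem integral_cTransform_add_integral_le_wassersteinDist_sq (r : Density X) :
    ∫ y, X.cTransform (kantorovichPotential Φ) y ∂p.toMeasure +
      ∫ x, kantorovichPotential Φ x ∂r.toMeasure ≤ X.wassersteinDist p r ^ 2 :=
  integral_cTransform_add_integral_le hΦ.bddAbove_kantorovichPotential
    hΦ.isSmooth_kantorovichPotential.isPeriodic p r
    (r.integrable_of_continuousOn hΦ.isSmooth_kantorovichPotential.continuousOn)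

theorem exists_sqDist_transportMap_le : ∃ L : NNReal, ∀ x ∈ X.cover, ∀ y ∈ X.cover,
    X.sqDist (X.transportMap Φ x) y ≤
      X.cTransform (kantorovichPotential Φ) (X.transportMap Φ x) + kantorovichPotential Φ y +
        2 * L * ‖x - y‖ ^ 2 := by
  obtain ⟨L, hL⟩ := hΦ.exists_sub_sub_inner_grad_le
  refine ⟨L, fun x hx y hy => ?_⟩
  have sqDist_le := sqDist_reduce_le (X := X) (X.grad Φ x) y
  rw [norm_sub_rev, norm_sub_sq_eq_potential_add x y (X.grad Φ x) (Φ x) (Φ y)] at sqDist_le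
  rw [hΦ.cTransform_transportMap hx]
  simp only [transportMap, kantorovichPotential]
  linarith [hL x hx y hy]

theorem exists_wassersteinDist_sq_le : ∃ L : NNReal, ∀ (r : Density X) (γ : Measure (𝔼 d × 𝔼 d)),
    IsCoupling γ q.toMeasure r.toMeasure → X.wassersteinDist p r ^ 2 ≤
      ∫ y, X.cTransform (kantorovichPotential Φ) y ∂p.toMeasure +
        ∫ x, kantorovichPotential Φ x ∂r.toMeasure + 2 * L * (quadCost γ).toReal := by
  obtain ⟨L, hL⟩ := hΦ.exists_sqDist_transportMap_le
  set η := kantorovichPotential Φ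
  set S := X.transportMap Φ
  refine ⟨L, fun r γ hγ => ?_⟩
  have hπ : IsCoupling (γ.map fun z => (S z.1, z.2)) p.toMeasure r.toMeasure :=
    hΦ.map_transportMap ▸ hγ.map_left hΦ.aemeasurable_transportMap
  have aemeasurable_S : AEMeasurable (fun z => (S z.1, z.2)) γ :=
    ((hγ.map_fst ▸ hΦ.aemeasurable_transportMap).comp_measurable measurable_fst).prodMk
      measurable_snd.aemeasurable
  have integrable_cTransform := integrable_cTransform hΦ.bddAbove_kantorovichPotential p
  have integrable_η := r.integrable_of_continuousOn hΦ.isSmooth_kantorovichPotential.continuousOn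
  have integrable_sum := hπ.integrable_fst_add_snd integrable_cTransform integrable_η
  have integrable_gap := (integrable_sqDist hπ).sub integrable_sum
  have gap_le : ∀ᵐ z ∂γ, X.sqDist (S z.1) z.2 - (X.cTransform η (S z.1) + η z.2) ≤
      2 * L * ‖z.1 - z.2‖ ^ 2 := by
    filter_upwards [ae_fst_mem_cell hγ, ae_snd_mem_cell hγ] with ⟨x, y⟩ hx hy
    exact sub_le_iff_le_add'.2 (hL x (X.cell_subset_cover hx) y (X.cell_subset_cover hy))
  have integral_gap_le := integral_mono_ae (integrable_gap.comp_aemeasurable aemeasurable_S)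
    ((integrable_norm_sub_sq (quadCost_ne_top_of_isCoupling hγ)).const_mul (2 * L)) gap_le
  rw [integral_const_mul, integral_norm_sub_sq] at integral_gap_le
  refine (wassersteinDist_sq_le hπ).trans ?_
  rw [← hπ.integral_fst_add_snd integrable_cTransform integrable_η, ← sub_le_iff_le_add',
    ← integral_sub (integrable_sqDist hπ) integrable_sum]
  exact (integral_map aemeasurable_S integrable_gap.1).trans_le integral_gap_le

end IsTransportPotential

variable {p q : Density X}

section Integral

variable {f g : 𝔼 d → ℝ}

theorem integral_add (hf : X.IsSmooth f) (hg : X.IsSmooth g) :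
    X.integral (fun x => f x + g x) = X.integral f + X.integral g :=
  MeasureTheory.integral_add (integrableOn_cell hf.continuousOn) (integrableOn_cell hg.continuousOn)

theorem integral_sub (hf : X.IsSmooth f) (hg : X.IsSmooth g) :
    X.integral (fun x => f x - g x) = X.integral f - X.integral g :=
  MeasureTheory.integral_sub (integrableOn_cell hf.continuousOn) (integrableOn_cell hg.continuousOn)

theorem integral_const_mul (a : ℝ) (f : 𝔼 d → ℝ) :
    X.integral (fun x => a * f x) = a * X.integral f :=
  MeasureTheory.integral_const_mul a f

end Integral

namespace Density

variable {σ : 𝔼 d → ℝ}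

theorem exists_abs_le_mul_of_eventually_eq {c : ℝ → Density X}
    (hc : ∀ᶠ t in 𝓝 (0 : ℝ), ∀ x ∈ X.cover, c t x = q x + t * σ x) :
    ∃ C, ∀ x ∈ X.cover, |σ x| ≤ C * q x := by
  have hc_neg := (continuous_neg.tendsto' (0 : ℝ) 0 neg_zero).eventually hc
  obtain ⟨t, ⟨hpos, hneg⟩, ht⟩ :=
    (((hc.and hc_neg).filter_mono nhdsWithin_le_nhds).and (self_mem_nhdsWithin (s := Ioi 0))).exists
  refine ⟨t⁻¹, fun x hx => ?_⟩
  have add_nonneg := (c t).nonneg x hx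
  have sub_nonneg := (c (-t)).nonneg x hx
  rw [hpos x hx] at add_nonneg
  rw [hneg x hx] at sub_nonneg
  rw [← div_eq_inv_mul, le_div_iff₀ ht, ← abs_of_pos ht, ← abs_mul, abs_le]
  constructor <;> linarith

theorem integral_toMeasure_of_eq_add_mul {r : Density X} {η : 𝔼 d → ℝ}
    (hη : X.IsSmooth η) (hσ : X.IsSmooth σ) {t : ℝ} (hr : ∀ x ∈ X.cover, r x = q x + t * σ x) :
    ∫ x, η x ∂r.toMeasure = ∫ x, η x ∂q.toMeasure + t * X.integral fun x => η x * σ x := by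
  have integral_eq : X.integral (fun x => η x * r x) =
      X.integral fun x => η x * q x + t * (η x * σ x) :=
    integral_congr fun x hx => by rw [hr x hx, mul_add, mul_left_comm]
  rw [integral_toMeasure, integral_toMeasure, integral_eq,
    SampleSpace.integral_add (hη.mul q.smooth) ((hη.mul hσ).const_mul t),
    SampleSpace.integral_const_mul]

end Density

theorem IsTransportPotential.isFirstVariation {Φ : 𝔼 d → ℝ}
    (hΦ : X.IsTransportPotential q p Φ) (hq : ∀ x ∈ interior X.cover, 0 < q x) :
    X.IsFirstVariation (fun r => X.wassersteinDist p r ^ 2) q (kantorovichPotential Φ) := by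
  have smooth := hΦ.isSmooth_kantorovichPotential
  refine ⟨smooth, fun σ hσ hσ₀ c hc => ?_⟩
  obtain ⟨L, hL⟩ := hΦ.exists_wassersteinDist_sq_le
  obtain ⟨C, hC⟩ := Density.exists_abs_le_mul_of_eventually_eq hc
  refine hasDerivAt_of_eventually_le_of_eventually_le
    (A := ∫ y, X.cTransform (kantorovichPotential Φ) y ∂p.toMeasure +
      ∫ x, kantorovichPotential Φ x ∂q.toMeasure) ?_ fun ε hε => ?_
  · filter_upwards [hc] with t ht
    have := hΦ.integral_cTransform_add_integral_le_wassersteinDist_sq (c t)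
    rw [sub_zero]
    rwa [Density.integral_toMeasure_of_eq_add_mul smooth hσ ht, ← add_assoc] at this
  · filter_upwards [hc, Density.eventually_exists_isCoupling_add_mul hq hσ hσ₀ hC
      (ε := ε / (2 * L + 1)) (by positivity)] with t ht exists_coupling
    obtain ⟨γ, hγ, cost_le⟩ := exists_coupling (c t) ht
    have toReal_cost_le := ENNReal.toReal_le_of_le_ofReal (by positivity) cost_le
    have := hL (c t) γ hγ
    rw [Density.integral_toMeasure_of_eq_add_mul smooth hσ ht, ← add_assoc] at this
    rw [sub_zero]
    refine this.trans (add_le_add_right ?_ _)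
    calc 2 * L * (quadCost γ).toReal ≤ (2 * L + 1) * (|t| * (ε / (2 * L + 1))) := by
          gcongr
          linarith
      _ = ε * |t| := by field_simp

variable {q : Density X}

section Uniqueness

variable {E : Type*} [NormedAddCommGroup E]

theorem ae_eq_zero_of_integral_norm_sq_mul_eq_zero (hq : ∀ x ∈ interior X.cover, 0 < q x)
    {g : 𝔼 d → E} (hg : ContinuousOn g X.cover)
    (h : X.integral (fun x => ‖g x‖ ^ 2 * q x) = 0) :
    ∀ᵐ x ∂(volume.restrict X.cell), g x = 0 := by
  rw [integral, integral_eq_zero_iff_of_nonneg_ae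
    (q.ae_nonneg.mono fun x hx => mul_nonneg (sq_nonneg _) hx)
    (integrableOn_cell ((hg.norm.pow 2).mul q.smooth.continuousOn))] at h
  filter_upwards [h, X.ae_mem_interior_cell] with x hx hxi
  have hqx := hq x (interior_mono X.cell_subset_cover hxi)
  simpa [hqx.ne'] using hx

end Uniqueness

section FirstVariation

variable {η₁ η₂ u : 𝔼 d → ℝ}

/-- The density `(1 + u) q`, for a perturbation `u` with values at least `-1`. -/
def Density.perturb (q : Density X) (hu : X.IsSmooth u)
    (hu₀ : X.integral (fun x => u x * q x) = 0) (hu₁ : ∀ x ∈ X.cover, -1 ≤ u x) : Density X where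
  toFun x := q x + u x * q x
  smooth := q.smooth.add (hu.mul q.smooth)
  nonneg x hx := by
    rw [← one_add_mul]
    exact mul_nonneg (by linarith [hu₁ x hx]) (q.nonneg x hx)
  integral_eq_one := by
    rw [integral_add q.smooth (hu.mul q.smooth), hu₀, q.integral_eq_one, add_zero]
  eq_zero_of_notMem x hx := by rw [q.eq_zero_of_notMem x hx, mul_zero, add_zero]

theorem Density.exists_curve (q : Density X) (hu : X.IsSmooth u)
    (hu₀ : X.integral (fun x => u x * q x) = 0) :
    ∃ c : ℝ → Density X, ∀ᶠ t in 𝓝 (0 : ℝ), ∀ x ∈ X.cover, c t x = q x + t * (u x * q x) := by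
  obtain ⟨M, hM⟩ := hu.exists_abs_le
  have eventually_le : ∀ᶠ t : ℝ in 𝓝 0, |t| * M ≤ 1 :=
    (continuous_abs.mul continuous_const).continuousAt.eventually_le_const (by simp)
  have exists_density : ∀ t : ℝ, |t| * M ≤ 1 → ∃ r : Density X,
      ∀ x ∈ X.cover, r x = q x + t * (u x * q x) := by
    intro t ht
    refine ⟨q.perturb (hu.const_mul t) ?_ fun x hx => ?_, fun x _ => ?_⟩
    · simp only [mul_assoc, integral_const_mul, hu₀, mul_zero]
    · refine (abs_le.1 ?_).1
      rw [abs_mul]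
      exact (mul_le_mul_of_nonneg_left (hM x hx) (abs_nonneg t)).trans ht
    · rw [← mul_assoc]
      rfl
  have : Nonempty (Density X) := ⟨q⟩
  choose! c hc using exists_density
  exact ⟨c, eventually_le.mono hc⟩

theorem IsFirstVariation.integral_sub_mul_eq_zero {G : Density X → ℝ}
    (h₁ : X.IsFirstVariation G q η₁) (h₂ : X.IsFirstVariation G q η₂) (hu : X.IsSmooth u)
    (hu₀ : X.integral (fun x => u x * q x) = 0) :
    X.integral (fun x => (η₁ x - η₂ x) * (u x * q x)) = 0 := by
  obtain ⟨c, hc⟩ := q.exists_curve hu hu₀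
  have hσ := hu.mul q.smooth
  simp only [sub_mul]
  rw [integral_sub (h₁.1.mul hσ) (h₂.1.mul hσ), sub_eq_zero]
  exact (h₁.2 _ hσ hu₀ c hc).unique (h₂.2 _ hσ hu₀ c hc)

theorem IsFirstVariation.exists_ae_eq_add_const (hq : ∀ x ∈ interior X.cover, 0 < q x)
    {G : Density X → ℝ} (h₁ : X.IsFirstVariation G q η₁) (h₂ : X.IsFirstVariation G q η₂) :
    ∃ a : ℝ, ∀ᵐ x ∂(volume.restrict X.cell), η₁ x = η₂ x + a := by
  have sub_smooth := h₁.1.sub h₂.1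
  set a := X.integral fun x => (η₁ x - η₂ x) * q x with ha
  set u := fun x => η₁ x - η₂ x - a
  have hu : X.IsSmooth u := sub_smooth.sub (.const a)
  have hu₀ : X.integral (fun x => u x * q x) = 0 := by
    simp only [u, sub_mul _ a]
    rw [integral_sub (sub_smooth.mul q.smooth) (q.smooth.const_mul a), integral_const_mul,
      q.integral_eq_one, mul_one, ← ha, sub_self]
  have integral_sq : X.integral (fun x => ‖u x‖ ^ 2 * q x) = 0 := calc
    _ = X.integral fun x => (η₁ x - η₂ x) * (u x * q x) - a * (u x * q x) :=
      integral_congr fun x _ => by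
        simp only [Real.norm_eq_abs, sq_abs, u]
        ring
    _ = 0 := by
      rw [integral_sub (sub_smooth.mul (hu.mul q.smooth)) ((hu.mul q.smooth).const_mul a),
        integral_const_mul, h₁.integral_sub_mul_eq_zero h₂ hu hu₀, hu₀, mul_zero, sub_zero]
  refine ⟨a, ?_⟩
  filter_upwards [ae_eq_zero_of_integral_norm_sq_mul_eq_zero hq hu.continuousOn integral_sq]
    with x hx
  linarith

end FirstVariation

section WassersteinGradient

variable {f Ψ η ζ : 𝔼 d → ℝ}

theorem IsTangentPotential.sub (hΨ : X.IsTangentPotential q Ψ) (hf : X.IsTangentPotential q f) :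
    X.IsTangentPotential q fun x => Ψ x - f x := by
  refine ⟨hΨ.1.sub hf.1, fun x hx n hn => ?_⟩
  rw [grad_sub hx (hΨ.1.differentiableOn x hx) (hf.1.differentiableOn x hx), inner_sub_left,
    mul_sub, hΨ.2 x hx n hn, hf.2 x hx n hn, sub_self]

theorem metric_sub_self (hΨ : X.IsSmooth Ψ) (hf : X.IsSmooth f) :
    X.metric q Ψ (fun x => Ψ x - f x) - X.metric q f (fun x => Ψ x - f x) =
      X.integral fun x => ‖X.grad Ψ x - X.grad f x‖ ^ 2 * q x := by
  have integrable : ∀ g, X.IsSmooth g →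
      IntegrableOn (fun x => ⟪X.grad g x, X.grad (fun x => Ψ x - f x) x⟫ * q x) X.cell :=
    fun g hg => integrableOn_cell ((hg.contDiffOn_grad.continuousOn.inner
      (hΨ.sub hf).contDiffOn_grad.continuousOn).mul q.smooth.continuousOn)
  rw [metric, metric, integral, integral,
    ← MeasureTheory.integral_sub (integrable Ψ hΨ) (integrable f hf), ← integral]
  refine integral_congr fun x hx => ?_
  simp only [grad_sub hx (hΨ.differentiableOn x hx) (hf.differentiableOn x hx)]
  rw [← sub_mul, ← inner_sub_left, real_inner_self_eq_norm_sq]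

theorem ae_grad_eq_of_metric_eq (hq : ∀ x ∈ interior X.cover, 0 < q x)
    (hΨ : X.IsTangentPotential q Ψ) (hf : X.IsTangentPotential q f)
    (h : ∀ Φ, X.IsTangentPotential q Φ → X.metric q Ψ Φ = X.metric q f Φ) :
    ∀ᵐ x ∂(volume.restrict X.cell), X.grad Ψ x = X.grad f x := by
  filter_upwards [ae_eq_zero_of_integral_norm_sq_mul_eq_zero hq
    (hΨ.1.contDiffOn_grad.continuousOn.sub hf.1.contDiffOn_grad.continuousOn)
    ((metric_sub_self hΨ.1 hf.1).symm.trans (by rw [h _ (hΨ.sub hf), sub_self]))] with x hx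
  exact sub_eq_zero.1 hx

theorem IsWassersteinGradient.integral_mul (hζ : X.IsWassersteinGradient q f ζ)
    (hq : ∀ x ∈ interior X.cover, 0 < q x) (hf : X.IsTangentPotential q f) (hη : X.IsSmooth η) :
    X.integral (fun x => ζ x * η x) = X.metric q f η := by
  obtain ⟨Ψ, hΨ, hζΨ, hmetric⟩ := hζ
  have grad_eq := ae_grad_eq_of_metric_eq hq hΨ hf fun Φ hΦ => by
    rw [hmetric Φ hΦ, integral_mul_tangent hΦ hf.1]
    simp only [metric, real_inner_comm]
  calc X.integral (fun x => ζ x * η x)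
    _ = X.integral fun x => η x * X.tangent q Ψ x :=
      integral_congr fun x hx => by simp only [hζΨ x hx, mul_comm]
    _ = X.metric q Ψ η := integral_mul_tangent hΨ hη
    _ = X.metric q f η := integral_congr_ae <| by filter_upwards [grad_eq] with x hx; rw [hx]

theorem IsTransportPotential.metric_kantorovichPotential {p : Density X}
    {Φ : 𝔼 d → ℝ} (hΦ : X.IsTransportPotential q p Φ) :
    X.metric q f (kantorovichPotential Φ) =
      -2 * X.integral fun x => ⟪X.grad f x, X.grad Φ x - x⟫ * q x := by
  rw [metric, ← integral_const_mul]
  refine integral_congr fun x hx => ?_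
  simp only [hΦ.grad_kantorovichPotential hx]
  rw [← neg_sub, smul_neg, inner_neg_right, real_inner_smul_right]
  ring

theorem metric_add_const (a : ℝ) : X.metric q f (fun x => η x + a) = X.metric q f η := by
  simp only [metric, grad, gradientWithin, fderivWithin_add_const]

end WassersteinGradient

end SampleSpace

theorem mainTheorem10 {d : ℕ} (X : SampleSpace d) (F : SampleSpace.Density X → ℝ)
    (p q : SampleSpace.Density X) (hq : ∀ x ∈ interior X.cover, 0 < q x)
    (f : EuclideanSpace ℝ (Fin d) → ℝ) (hf : X.IsFirstVariation F q f)
    (hflux : X.IsTangentPotential q f)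
    (Φ : EuclideanSpace ℝ (Fin d) → ℝ) (hΦ : X.IsTransportPotential q p Φ) :
    X.IsWassersteinGradient q f (X.tangent q f) ∧
    (∃ η, X.IsFirstVariation (fun r => X.wassersteinDist p r ^ 2) q η) ∧
    ∀ ζ η : EuclideanSpace ℝ (Fin d) → ℝ,
      X.IsWassersteinGradient q f ζ →
      X.IsFirstVariation (fun r => X.wassersteinDist p r ^ 2) q η →
      X.transportBregman F p q f Φ =
        F p - F q + (1 / 2) * X.integral (fun x => ζ x * η x) := by
  have hη₀ := hΦ.isFirstVariation hq
  refine ⟨hflux.isWassersteinGradient, ⟨_, hη₀⟩, fun ζ η hζ hη => ?_⟩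
  obtain ⟨a, ha⟩ := hη.exists_ae_eq_add_const hq hη₀
  have integral_eq : X.integral (fun x => ζ x * η x) =
      -2 * X.integral fun x => ⟪X.grad f x, X.grad Φ x - x⟫ * q x := calc
    _ = X.integral fun x => ζ x * (SampleSpace.kantorovichPotential Φ x + a) :=
      integral_congr_ae <| ha.mono fun x hx => by simp only [hx]
    _ = X.metric q f fun x => SampleSpace.kantorovichPotential Φ x + a :=
      hζ.integral_mul hq hflux (hη₀.1.add (.const a))
    _ = _ := by rw [SampleSpace.metric_add_const, hΦ.metric_kantorovichPotential]
  rw [SampleSpace.transportBregman, integral_eq]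
  ring
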